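/- **Proposition (involutive connected $\mathcal P$-Hopf algebra).** Let $K$ be a field with an involution $\lambda\mapsto\bar\lambda$ (a ring automorphism with $\bar{\bar\lambda}=\lambda$; the identity is allowed). *The grove algebra.* Consider planar rooted trees all of whose internal vertices have at least two inputs. Let $(0)$ be the tree with one leaf; every other tree is uniquely a grafting $t=t_1\vee\dots\vee t_n$, $n\ge 2$. A grove is a finite set of trees. Define the grove $t\,\dot\pm\,z$ by $(0)\,\dot\pm\,z=\{z\}$, $t\,\dot\pm\,(0)=\{t\}$ and $t\,\dot\pm\,z=(t\dashv z)\cup(t\vdash z)\cup(t\perp z)$ for $t,z\neq(0)$, where, for $t=t_1\vee\dots\vee t_n$ and $z=z_1\vee\dots\vee z_m$, and with grafting applied elementwise to groves, $$t\vdash z=(t\,\dot\pm\,z_1)\vee z_2\vee\dots\vee z_m,\quad t\dashv z=t_1\vee\dots\vee t_{n-1}\vee(t_n\,\dot\pm\,z),\quad t\perp z=t_1\vee\dots\vee t_{n-1}\vee(t_n\,\dot\pm\,z_1)\vee z_2\vee\dots\vee z_m .$$ For $t\ne(0)$ put $(0)\vdash t=\{t\}=t\dashv(0)$ and $(0)\dashv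 t=t\vdash(0)=(0)\perp t=t\perp(0)=\emptyset$. Let $H$ be the $K$-vector space with basis $X^{t}$, $t$ a tree; write $1=X^{(0)}$, $X^{G}=\sum_{t\in G}X^t$ for a grove $G$, and let $\varepsilon:H\to K$ be the coefficient of $1$. Define $\prec,\succ,\bullet$ bilinearly by $X^t\prec X^z=X^{t\dashv z}$, $X^t\succ X^z=X^{t\vdash z}$, $X^t\bullet X^z=X^{t\perp z}$ (the symbols $1\circ1$, $\circ\in\{\prec,\succ,\bullet\}$, have no meaning), and let $x\star y=x\prec y+x\succ y+x\bullet y$, with $1\star1=1$. Extend $\vee$ and $\star$ multilinearly to $H$. Let $\dagger$ be the conjugate-linear map with $(X^t)^\dagger=X^{t^\dagger}$, where $(0)^\dagger=(0)$ and $(t_1\vee\dots\vee t_n)^\dagger=t_n^\dagger\vee\dots\vee t_1^\dagger$. On $H\otimes H$ put, for $\circ\in\{\prec,\succ,\bullet\}$ and trees $b,b'$, $(X^a\otimes X^b)\circ(X^{a'}\otimes X^{b'})=(X^a\star X^{a'})\otimes(X^b\circ X^{b'})$ if $(b,b')\neq((0),(0))$, and $(X^a\otimes1)\circ(X^{a'}\otimes1)=(X^a\circ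 X^{a'})\otimes1$. *Claim.* There is a linear map $\Delta:H\to H\otimes H$ with $\Delta(1)=1\otimes1$ such that for all trees $v_1,\dots,v_m$, $m\ge2$ (Sweedler notation $\Delta(X^{v_i})=\sum X^{v_{i,(1)}}\otimes X^{v_{i,(2)}}$), $$\Delta(X^{v_1\vee\dots\vee v_m})=X^{v_1\vee\dots\vee v_m}\otimes1+\sum X^{v_{1,(1)}}\star\dots\star X^{v_{m,(1)}}\otimes X^{v_{1,(2)}}\vee\dots\vee X^{v_{m,(2)}},$$ and $\Delta$ is an involutive connected $\mathcal P$-Hopf algebra structure on $H$, $\mathcal P$ being the operad of dendriform trialgebras. This means: 1. $H$ and $H\otimes H$ are dendriform trialgebras augmented by a unit: for $x,y,z$ in the augmentation ideal, $(x\prec y)\prec z=x\prec(y\star z)$, $(x\succ y)\prec z=x\succ(y\prec z)$, $(x\star y)\succ z=x\succ(y\succ z)$, $(x\succ y)\bullet z=x\succ(y\bullet z)$, $(x\prec y)\bullet z=x\bullet(y\succ z)$, $(x\bullet y)\prec z=x\bullet(y\prec z)$, $(x\bullet y)\bullet z=x\bullet(y\bullet z)$, and $1\prec x=x\succ1=1\bullet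 x=x\bullet 1=0$, $x\prec1=x=1\succ x$ (with $1\otimes 1$ in place of $1$ for $H\otimes H$); 2. $\Delta$ is coassociative with counit $\varepsilon$, and $\Delta(x\circ y)=\Delta(x)\circ\Delta(y)$ for $x,y\in\ker\varepsilon$, $\circ\in\{\prec,\succ,\bullet\}$; there is an antipode, that is, a linear map $S:H\to H$ which is a two-sided convolution inverse of the identity for $\star$ and $\Delta$; 3. $H=\bigcup_r F_r$, where $F_0=K1$ and $F_{r+1}=\{x:\Delta(x)-1\otimes x-x\otimes1\in F_r\otimes F_r\}$ (connectedness); 4. on $H$ and, with $(x\otimes y)^\dagger=x^\dagger\otimes y^\dagger$, on $H\otimes H$, the map $\dagger$ is an involution fixing the unit, compatible with the augmentation, with $(x\prec y)^\dagger=y^\dagger\succ x^\dagger$, $(x\succ y)^\dagger=y^\dagger\prec x^\dagger$, $(x\bullet y)^\dagger=y^\dagger\bullet x^\dagger$, and $\Delta(x^\dagger)=\Delta(x)^\dagger$. Furthermore, if $x,y\in H$ are primitive, i.e. $\Delta(x)=x\otimes1+1\otimes x$ and likewise for $y$, then $x\bullet y$ is primitive. -/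

import Mathlib

open scoped TensorProduct

/-! ### Planar rooted trees and the dendriform operations on groves -/

/-- Planar rooted trees all of whose internal vertices have at least two inputs.
`leaf` is the tree `(0)` with one leaf and no internal vertex, and `node l [s₁, …, sₖ] r` is the
grafting `l ∨ s₁ ∨ ⋯ ∨ sₖ ∨ r`. -/
inductive PTree : Type
  | leaf : PTree
  | node (l : PTree) (mid : List PTree) (r : PTree) : PTree

namespace PTree

noncomputable instance : DecidableEq PTree := Classical.decEq PTree

/-- The dendriform involution `(t₁ ∨ ⋯ ∨ tₘ)† = tₘ† ∨ ⋯ ∨ t₁†`. -/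
def dagger : PTree → PTree
  | leaf => leaf
  | node l mid r => node (dagger r) (mid.map dagger).reverse (dagger l)

/-- The grafting `v₁ ∨ ⋯ ∨ vₘ₊₂` of a family of at least two trees. -/
def graft {m : ℕ} (v : Fin (m + 2) → PTree) : PTree :=
  node (v 0) (List.ofFn fun i : Fin m => v i.castSucc.succ) (v (Fin.last (m + 1)))

/-- The dendriform addition of two trees, a grove (finite set of trees): `(0)` is neutral, and
for `t = t₁ ∨ ⋯ ∨ tₙ`, `z = z₁ ∨ ⋯ ∨ zₘ` it is the union of the groves
`(t ∔ z₁) ∨ z₂ ∨ ⋯ ∨ zₘ`, `t₁ ∨ ⋯ ∨ tₙ₋₁ ∨ (tₙ ∔ z)` and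
`t₁ ∨ ⋯ ∨ tₙ₋₁ ∨ (tₙ ∔ z₁) ∨ z₂ ∨ ⋯ ∨ zₘ`. -/
noncomputable def add : PTree → PTree → Finset PTree
  | leaf, z => {z}
  | node l mid r, leaf => {node l mid r}
  | node l mid r, node l' mid' r' =>
      (add (node l mid r) l').image (fun u => node u mid' r') ∪
        (add r (node l' mid' r')).image (fun u => node l mid u) ∪
        (add r l').image (fun u => node l (mid ++ u :: mid') r')
termination_by t z => sizeOf t + sizeOf z

/-- `t ⊢ (z₁ ∨ ⋯ ∨ zₘ) = (t ∔ z₁) ∨ z₂ ∨ ⋯ ∨ zₘ` and `t ⊢ (0) = ∅`.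
(The symbol `(0) ⊢ (0)` is meaningless and gets the dummy value `∅`.) -/
noncomputable def vdash : PTree → PTree → Finset PTree
  | _, leaf => ∅
  | t, node l mid r => (add t l).image (fun u => node u mid r)

/-- `(t₁ ∨ ⋯ ∨ tₙ) ⊣ z = t₁ ∨ ⋯ ∨ tₙ₋₁ ∨ (tₙ ∔ z)` and `(0) ⊣ z = ∅`.
(The symbol `(0) ⊣ (0)` is meaningless and gets the dummy value `∅`.) -/
noncomputable def dashv : PTree → PTree → Finset PTree
  | leaf, _ => ∅
  | node l mid r, z => (add r z).image (fun u => node l mid u)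

/-- `(t₁ ∨ ⋯ ∨ tₙ) ⊥ (z₁ ∨ ⋯ ∨ zₘ) = t₁ ∨ ⋯ ∨ tₙ₋₁ ∨ (tₙ ∔ z₁) ∨ z₂ ∨ ⋯ ∨ zₘ`, and
`(0) ⊥ z = ∅ = t ⊥ (0)`.
(The symbol `(0) ⊥ (0)` is meaningless and gets the dummy value `∅`.) -/
noncomputable def perp : PTree → PTree → Finset PTree
  | node l mid r, node l' mid' r' =>
      (add r l').image (fun u => node l (mid ++ u :: mid') r')
  | _, _ => ∅

end PTree

/-! ### Augmented dendriform trialgebras and `P`-Hopf algebras over them -/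

/-- The data of an augmented dendriform trialgebra: unit, augmentation and the three operations.
The operations are only meaningful when one of the arguments lies in the augmentation ideal; the
meaningless values `1 ∘ 1` are normalised to `0` in `TriData.IsAugTrialgebra`. -/
structure TriData (K A : Type*) [CommRing K] [AddCommGroup A] [Module K A] where
  one : A
  aug : A →ₗ[K] K
  prec : A →ₗ[K] A →ₗ[K] A
  succ : A →ₗ[K] A →ₗ[K] A
  bullet : A →ₗ[K] A →ₗ[K] A

namespace TriData

variable {K A : Type*} [CommRing K] [AddCommGroup A] [Module K A]

/-- The bilinear map `(x, y) ↦ ε(x) ε(y) 1`. -/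
noncomputable def unitPart (D : TriData K A) : A →ₗ[K] A →ₗ[K] A :=
  D.aug.smulRight (D.aug.smulRight D.one)

/-- The product `x ⋆ y = x ≺ y + x ≻ y + x • y`, with `1 ⋆ 1 = 1`. -/
noncomputable def star (D : TriData K A) : A →ₗ[K] A →ₗ[K] A :=
  D.prec + D.succ + D.bullet + D.unitPart

/-- `(A, 1, ε, ≺, ≻, •)` is a dendriform trialgebra `ker ε` augmented by the unit `1`. -/
structure IsAugTrialgebra (D : TriData K A) : Prop where
  aug_one : D.aug D.one = 1
  aug_prec : ∀ x y, D.aug (D.prec x y) = 0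
  aug_succ : ∀ x y, D.aug (D.succ x y) = 0
  aug_bullet : ∀ x y, D.aug (D.bullet x y) = 0
  one_prec_one : D.prec D.one D.one = 0
  one_succ_one : D.succ D.one D.one = 0
  one_bullet_one : D.bullet D.one D.one = 0
  one_prec : ∀ x, D.aug x = 0 → D.prec D.one x = 0
  prec_one : ∀ x, D.aug x = 0 → D.prec x D.one = x
  one_succ : ∀ x, D.aug x = 0 → D.succ D.one x = x
  succ_one : ∀ x, D.aug x = 0 → D.succ x D.one = 0
  one_bullet : ∀ x, D.aug x = 0 → D.bullet D.one x = 0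
  bullet_one : ∀ x, D.aug x = 0 → D.bullet x D.one = 0
  prec_prec : ∀ x y z, D.aug x = 0 → D.aug y = 0 → D.aug z = 0 →
    D.prec (D.prec x y) z = D.prec x (D.star y z)
  succ_prec : ∀ x y z, D.aug x = 0 → D.aug y = 0 → D.aug z = 0 →
    D.prec (D.succ x y) z = D.succ x (D.prec y z)
  star_succ : ∀ x y z, D.aug x = 0 → D.aug y = 0 → D.aug z = 0 →
    D.succ (D.star x y) z = D.succ x (D.succ y z)
  succ_bullet : ∀ x y z, D.aug x = 0 → D.aug y = 0 → D.aug z = 0 →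
    D.bullet (D.succ x y) z = D.succ x (D.bullet y z)
  prec_bullet : ∀ x y z, D.aug x = 0 → D.aug y = 0 → D.aug z = 0 →
    D.bullet (D.prec x y) z = D.bullet x (D.succ y z)
  bullet_prec : ∀ x y z, D.aug x = 0 → D.aug y = 0 → D.aug z = 0 →
    D.prec (D.bullet x y) z = D.bullet x (D.prec y z)
  bullet_bullet : ∀ x y z, D.aug x = 0 → D.aug y = 0 → D.aug z = 0 →
    D.bullet (D.bullet x y) z = D.bullet x (D.bullet y z)

/-- The extension of an operation `∘` to the tensor square:
`(a ⊗ b) ∘ (a' ⊗ b') = (a ⋆ a') ⊗ (b ∘ b') + ε(b) ε(b') (a ∘ a') ⊗ 1`.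
As `1 ∘ 1 = 0` by normalisation, this means `(a ⊗ b) ∘ (a' ⊗ b') = (a ⋆ a') ⊗ (b ∘ b')` if `b` or
`b'` is in the augmentation ideal, and `(a ⊗ 1) ∘ (a' ⊗ 1) = (a ∘ a') ⊗ 1`. -/
noncomputable def tensorOp (D : TriData K A) (op : A →ₗ[K] A →ₗ[K] A) :
    (A ⊗[K] A) →ₗ[K] (A ⊗[K] A) →ₗ[K] (A ⊗[K] A) :=
  TensorProduct.map₂ D.star op + TensorProduct.map₂ op D.unitPart

theorem tensorOp_tmul (D : TriData K A) (op : A →ₗ[K] A →ₗ[K] A) (a b a' b' : A) :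
    D.tensorOp op (a ⊗ₜ b) (a' ⊗ₜ b') =
      D.star a a' ⊗ₜ op b b' + op a a' ⊗ₜ (D.aug b • D.aug b' • D.one) := by
  simp [tensorOp, unitPart]

/-- The tensor square of an augmented dendriform trialgebra. -/
noncomputable def tensor (D : TriData K A) : TriData K (A ⊗[K] A) where
  one := D.one ⊗ₜ D.one
  aug := LinearMap.mul' K K ∘ₗ TensorProduct.map D.aug D.aug
  prec := D.tensorOp D.prec
  succ := D.tensorOp D.succ
  bullet := D.tensorOp D.bullet

/-- The linear map `x ↦ Δ x - 1 ⊗ x - x ⊗ 1`. -/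
noncomputable def reduced (D : TriData K A) (Δ : A →ₗ[K] A ⊗[K] A) : A →ₗ[K] A ⊗[K] A :=
  Δ - TensorProduct.mk K A A D.one - (TensorProduct.mk K A A).flip D.one

/-- The primitive filtration `F₀ = K 1`,
`Fᵣ₊₁ = {x | Δ x - 1 ⊗ x - x ⊗ 1 ∈ Fᵣ ⊗ Fᵣ}`. -/
noncomputable def primFiltration (D : TriData K A) (Δ : A →ₗ[K] A ⊗[K] A) : ℕ → Submodule K A
  | 0 => Submodule.span K {D.one}
  | r + 1 => (LinearMap.range (TensorProduct.map (primFiltration D Δ r).subtype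
      (primFiltration D Δ r).subtype)).comap (D.reduced Δ)

/-- `Δ` is a connected `P`-Hopf algebra structure, for `P` the operad of dendriform trialgebras,
on the augmented dendriform trialgebra `D`: a coassociative counital coproduct that is a morphism
of augmented dendriform trialgebras, with an antipode for `⋆`, and an exhaustive primitive
filtration. -/
structure IsConnectedPHopf (D : TriData K A) (Δ : A →ₗ[K] A ⊗[K] A) : Prop where
  isAugTrialgebra : D.IsAugTrialgebra
  tensor_isAugTrialgebra : D.tensor.IsAugTrialgebra
  coassoc : (TensorProduct.assoc K A A A).toLinearMap ∘ₗ Δ.rTensor A ∘ₗ Δ = Δ.lTensor A ∘ₗ Δ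
  counit_left : D.aug.rTensor A ∘ₗ Δ = TensorProduct.mk K K A 1
  counit_right : D.aug.lTensor A ∘ₗ Δ = (TensorProduct.mk K A K).flip 1
  map_one : Δ D.one = D.tensor.one
  map_prec : ∀ x y, D.aug x = 0 → D.aug y = 0 → Δ (D.prec x y) = D.tensor.prec (Δ x) (Δ y)
  map_succ : ∀ x y, D.aug x = 0 → D.aug y = 0 → Δ (D.succ x y) = D.tensor.succ (Δ x) (Δ y)
  map_bullet : ∀ x y, D.aug x = 0 → D.aug y = 0 →
    Δ (D.bullet x y) = D.tensor.bullet (Δ x) (Δ y)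
  exists_antipode : ∃ S : A →ₗ[K] A,
    TensorProduct.lift D.star ∘ₗ S.rTensor A ∘ₗ Δ = D.aug.smulRight D.one ∧
    TensorProduct.lift D.star ∘ₗ S.lTensor A ∘ₗ Δ = D.aug.smulRight D.one
  connected : ∀ x, ∃ r, x ∈ D.primFiltration Δ r

/-- `x` is primitive: `Δ x = x ⊗ 1 + 1 ⊗ x`. -/
def IsPrimitive (D : TriData K A) (Δ : A →ₗ[K] A ⊗[K] A) (x : A) : Prop :=
  Δ x = x ⊗ₜ[K] D.one + D.one ⊗ₜ[K] x

variable [StarRing K]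

/-- A conjugate-linear map `†` is an involution of the augmented dendriform trialgebra `D`. -/
structure IsInvolution (D : TriData K A) (inv : A →ₛₗ[starRingEnd K] A) : Prop where
  inv_inv : ∀ x, inv (inv x) = x
  inv_one : inv D.one = D.one
  aug_inv : ∀ x, D.aug (inv x) = starRingEnd K (D.aug x)
  inv_prec : ∀ x y, inv (D.prec x y) = D.succ (inv y) (inv x)
  inv_succ : ∀ x y, inv (D.succ x y) = D.prec (inv y) (inv x)
  inv_bullet : ∀ x y, inv (D.bullet x y) = D.bullet (inv y) (inv x)

/-- `Δ` and `†` form an involutive connected `P`-Hopf algebra structure on `D`: `†` is an involution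
of `D`, `† ⊗ †` is an involution of `D ⊗ D`, and `Δ` commutes with them. -/
structure IsInvolutiveConnectedPHopf (D : TriData K A) (inv : A →ₛₗ[starRingEnd K] A)
    (Δ : A →ₗ[K] A ⊗[K] A) : Prop where
  isConnectedPHopf : D.IsConnectedPHopf Δ
  isInvolution : D.IsInvolution inv
  tensor_isInvolution : D.tensor.IsInvolution (TensorProduct.map inv inv)
  map_inv : ∀ x, Δ (inv x) = TensorProduct.map inv inv (Δ x)

end TriData

/-! ### The augmented grove algebra -/

/-- The vector space with basis `Xᵛ`, `v` a planar rooted tree. -/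
abbrev GroveAlgebra (K : Type*) [Field K] : Type _ := PTree →₀ K

namespace GroveAlgebra

variable (K : Type*) [Field K]

/-- The basis vector `Xᵛ`. -/
noncomputable def X (v : PTree) : GroveAlgebra K := Finsupp.single v 1

/-- `X` of a grove: the sum of the `Xᵛ` over the trees `v` of the grove. -/
noncomputable def XGrove (s : Finset PTree) : GroveAlgebra K := ∑ v ∈ s, X K v

/-- The bilinear operation with `Xᵛ ∘ Xʷ = X^(f v w)`. -/
noncomputable def groveOp (f : PTree → PTree → Finset PTree) :
    GroveAlgebra K →ₗ[K] GroveAlgebra K →ₗ[K] GroveAlgebra K :=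
  Finsupp.linearCombination K fun v => Finsupp.linearCombination K fun w => XGrove K (f v w)

/-- The augmented grove algebra `(K[groves], ≺, ≻, •)` with unit `X^(0)`. -/
noncomputable def triData : TriData K (GroveAlgebra K) where
  one := X K PTree.leaf
  aug := Finsupp.lapply PTree.leaf
  prec := groveOp K PTree.dashv
  succ := groveOp K PTree.vdash
  bullet := groveOp K PTree.perp

/-- The dendriform involution `λ Xᵛ ↦ λ̄ X^(v†)`. -/
noncomputable def dagger [StarRing K] : GroveAlgebra K →ₛₗ[starRingEnd K] GroveAlgebra K where
  toFun x := x.sum fun v c => starRingEnd K c • X K v.dagger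
  map_add' x y := by
    rw [Finsupp.sum_add_index'] <;> simp [add_smul]
  map_smul' c x := by
    rw [Finsupp.sum_smul_index'] <;> simp [Finsupp.smul_sum, mul_smul]

/-- The multilinear extension `x₁ ∨ ⋯ ∨ xₘ₊₂` of the grafting of trees. -/
noncomputable def graft {m : ℕ} (x : Fin (m + 2) → GroveAlgebra K) : GroveAlgebra K :=
  ∑ v ∈ Fintype.piFinset fun i => (x i).support, (∏ i, x i (v i)) • X K (PTree.graft v)

/-- The iterated product `x₁ ⋆ ⋯ ⋆ xₙ`. -/
noncomputable def starProd {n : ℕ} (x : Fin n → GroveAlgebra K) : GroveAlgebra K :=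
  (List.ofFn x).foldr (fun a b => (triData K).star a b) (triData K).one

/-- `Δ(Xᵛ) = Xᵛ ⊗ 1 + ∑ (v₁₍₁₎ ⋆ ⋯ ⋆ vₘ₍₁₎) ⊗ (v₁₍₂₎ ∨ ⋯ ∨ vₘ₍₂₎)` for `v = v₁ ∨ ⋯ ∨ vₘ`, `m ≥ 2`.
As usual for the Sweedler notation, the formula is required for all ways to write
`Δ(X^(vᵢ))` as a finite sum `∑ⱼ a i j ⊗ b i j`. -/
def SweedlerFormula (Δ : GroveAlgebra K →ₗ[K] GroveAlgebra K ⊗[K] GroveAlgebra K) : Prop :=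
  ∀ (m : ℕ) (v : Fin (m + 2) → PTree) (N : Fin (m + 2) → ℕ)
    (a b : (i : Fin (m + 2)) → Fin (N i) → GroveAlgebra K),
    (∀ i, Δ (X K (v i)) = ∑ j, a i j ⊗ₜ[K] b i j) →
    Δ (X K (PTree.graft v)) = X K (PTree.graft v) ⊗ₜ[K] (triData K).one +
      ∑ j : (i : Fin (m + 2)) → Fin (N i),
        starProd K (fun i => a i (j i)) ⊗ₜ[K] graft K (fun i => b i (j i))

end GroveAlgebra

/-! Everything is read off one trilinear grafting map. The branches of a tree form a word in the
free associative algebra on trees, and `nodeL l w r` grafts the letter `l`, the word `w` and the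
letter `r`. Each operation on graftings changes the word in one place: `≺ z` replaces `r` by `r ⋆
z`, `z ≻` replaces `l` by `z ⋆ l`, and `•` concatenates two words, merging the adjacent branches `r`
and `l'` into `r ⋆ l'` (`prec_nodeL`, `succ_nodeL`, `bullet_nodeL`). The trialgebra axioms thus
reduce to associativity of `⋆` on triples of smaller total degree, itself a sum of the axioms for
those triples.

The same map with coefficients in an algebra is `nodeT`. The tensor square operations obey the same
three rules on it, since `⋆` there is the usual tensor product multiplication and graftings have
augmentation zero. The coproduct is defined by Δ(nodeL l w r) = nodeL l w r ⊗ 1 + nodeT(Δl, Δw, Δr),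
with Δ multiplicative on words. Compatibility with the three operations follows by induction on
degree, and makes Δ an algebra morphism for `⋆`. Hence both iterated coproducts satisfy the same
recursion on trees, which gives coassociativity; the left counit law and commutation with `†`, which
reverses words, come from analogous recursions.

Finally Δ does not raise degree, where degree is the number of leaves minus one. With the counit
laws this bounds the primitive filtration and makes the projection π onto the augmentation ideal
locally nilpotent under convolution, so the antipode is the series ∑ (-1)ⁿ πⁿ of convolution powers.
-/

namespace PTree

/-- Structural induction on planar trees, with one hypothesis for each of the subtrees. -/
theorem induction_on {P : PTree → Prop} (t : PTree) (leaf : P leaf)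
    (node : ∀ l mid r, P l → (∀ s ∈ mid, P s) → P r → P (node l mid r)) : P t :=
  match t with
  | .leaf => leaf
  | .node l mid r =>
    node l mid r (induction_on l leaf node) (fun s _ => induction_on s leaf node)
      (induction_on r leaf node)
termination_by sizeOf t
decreasing_by
  · decreasing_tactic
  · have := List.sizeOf_lt_of_mem ‹s ∈ mid›
    simp only [PTree.node.sizeOf_spec]
    omega
  · decreasing_tactic

/-! ### Degree of trees and of their sums -/

/-- The degree of a planar tree, that is, its number of leaves minus one. -/
def deg : PTree → ℕ
  | leaf => 0
  | node l mid r => deg l + (mid.map deg).sum + deg r + mid.length + 1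

@[simp] theorem deg_leaf : deg leaf = 0 := by rw [deg]

theorem deg_node (l : PTree) (mid : List PTree) (r : PTree) :
    deg (node l mid r) = deg l + (mid.map deg).sum + deg r + mid.length + 1 := by rw [deg]

theorem deg_eq_zero_iff {t : PTree} : deg t = 0 ↔ t = leaf := by
  cases t <;> simp [deg_node]

@[simp] theorem add_leaf (t : PTree) : add t leaf = {t} := by
  cases t <;> rw [add]

@[simp] theorem leaf_add (t : PTree) : add leaf t = {t} := by rw [add]

theorem add_node_node (l : PTree) (mid : List PTree) (r l' : PTree) (mid' : List PTree)
    (r' : PTree) : add (node l mid r) (node l' mid' r') =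
      vdash (node l mid r) (node l' mid' r') ∪ dashv (node l mid r) (node l' mid' r') ∪
        perp (node l mid r) (node l' mid' r') := by
  rw [add, vdash, dashv, perp]

/-- Makes `⋆` homogeneous; this gives both the disjointness of the groves in a sum and the degree
bounds for the coproduct. -/
theorem deg_of_mem_add {t z u : PTree} (h : u ∈ add t z) : deg u = deg t + deg z := by
  induction t, z using add.induct generalizing u with
  | case1 z => simp_all
  | case2 l mid r => simp_all
  | case3 l mid r l' mid' r' h₁ h₂ h₃ =>
    rw [add] at h
    simp only [Finset.mem_union, Finset.mem_image] at h
    rcases h with (⟨a, ha, rfl⟩ | ⟨a, ha, rfl⟩) | ⟨a, ha, rfl⟩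
    · have := h₁ ha
      simp only [deg_node] at *
      omega
    · have := h₂ ha
      simp only [deg_node] at *
      omega
    · have := h₃ ha
      simp only [deg_node, List.map_append, List.map_cons, List.sum_append, List.sum_cons,
        List.length_append, List.length_cons] at *
      omega

end PTree

namespace TriData

theorem star_apply {K A : Type*} [CommRing K] [AddCommGroup A] [Module K A] (D : TriData K A)
    (x y : A) : D.star x y =
      D.prec x y + D.succ x y + D.bullet x y + (D.aug x * D.aug y) • D.one := by
  simp [star, unitPart, mul_smul]

end TriData

/-! ### The operations on basis vectors -/

namespace GroveAlgebra

variable {K : Type*} [Field K]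

open PTree

theorem induction_X {p : GroveAlgebra K → Prop} (x : GroveAlgebra K) (hX : ∀ t, p (X K t))
    (hadd : ∀ x y, p x → p y → p (x + y)) (hsmul : ∀ (c : K) x, p x → p (c • x)) : p x := by
  induction x using Finsupp.induction_linear with
  | zero => simpa using hsmul 0 _ (hX leaf)
  | add x y hx hy => exact hadd x y hx hy
  | single t c => simpa [X] using hsmul c _ (hX t)

theorem groveOp_X_X (f : PTree → PTree → Finset PTree) (t z : PTree) :
    groveOp K f (X K t) (X K z) = XGrove K (f t z) := by
  simp [groveOp, X]

theorem XGrove_image {f : PTree → PTree} (hf : Function.Injective f) (s : Finset PTree) :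
    XGrove K (s.image f) = ∑ u ∈ s, X K (f u) := by
  rw [XGrove, Finset.sum_image fun _ _ _ _ h => hf h]

/-- The union defining the sum is disjoint, so no multiplicity is lost. The groves of `⊢` and `⊣`
differ in the degree of the first branch, which is `deg t + deg l' > deg l` in the former; those of
`⊥` have more branches at the root than either. -/
theorem XGrove_add_node_node (l : PTree) (mid : List PTree) (r l' : PTree) (mid' : List PTree)
    (r' : PTree) : XGrove K (add (node l mid r) (node l' mid' r')) =
      XGrove K (dashv (node l mid r) (node l' mid' r')) +
        XGrove K (vdash (node l mid r) (node l' mid' r')) +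
        XGrove K (perp (node l mid r) (node l' mid' r')) := by
  have h₁ : Disjoint (vdash (node l mid r) (node l' mid' r'))
      (dashv (node l mid r) (node l' mid' r')) := by
    rw [Finset.disjoint_left, vdash, dashv]
    simp only [Finset.mem_image]
    rintro _ ⟨a, ha, rfl⟩ ⟨b, hb, hab⟩
    have := deg_of_mem_add ha
    rw [deg_node] at this
    injection hab with h _ _
    subst h
    omega
  have h₂ : Disjoint (vdash (node l mid r) (node l' mid' r') ∪
      dashv (node l mid r) (node l' mid' r')) (perp (node l mid r) (node l' mid' r')) := by
    rw [Finset.disjoint_left, vdash, dashv, perp]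
    simp only [Finset.mem_union, Finset.mem_image]
    rintro _ (⟨a, ha, rfl⟩ | ⟨a, ha, rfl⟩) ⟨b, hb, hab⟩
    all_goals
      injection hab with _ h _
      have := congrArg List.length h
      rw [List.length_append, List.length_cons] at this
      omega
  rw [add_node_node, XGrove, Finset.sum_union h₂, Finset.sum_union h₁]
  simp only [XGrove]
  abel

theorem aug_X_leaf : (triData K).aug (X K leaf) = 1 := by simp [triData, X]

theorem aug_X_node (l : PTree) (mid : List PTree) (r : PTree) :
    (triData K).aug (X K (node l mid r)) = 0 := by simp [triData, X]

theorem prec_X_X (t z : PTree) : (triData K).prec (X K t) (X K z) = XGrove K (dashv t z) :=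
  groveOp_X_X _ _ _

theorem succ_X_X (t z : PTree) : (triData K).succ (X K t) (X K z) = XGrove K (vdash t z) :=
  groveOp_X_X _ _ _

theorem bullet_X_X (t z : PTree) : (triData K).bullet (X K t) (X K z) = XGrove K (perp t z) :=
  groveOp_X_X _ _ _

theorem star_X_X (t z : PTree) : (triData K).star (X K t) (X K z) = XGrove K (add t z) := by
  rw [TriData.star_apply, prec_X_X, succ_X_X, bullet_X_X]
  cases t <;> cases z
  -- For two leaves all three groves take the dummy value `∅`; the unit part alone supplies `1 ⋆ 1 =
  -- 1`.
  · simp [aug_X_leaf, dashv, vdash, perp, XGrove]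
    rfl
  · simp [aug_X_node, dashv, vdash, perp, XGrove]
  · simp [aug_X_node, dashv, vdash, perp, XGrove]
  · simp [aug_X_node, XGrove_add_node_node]

/-! ### Words of trees and multilinear grafting -/

/-- The algebra of words in the planar trees. -/
abbrev Words (K : Type*) [Field K] : Type _ := MonoidAlgebra K (FreeMonoid PTree)

/-- The word with a given list of letters. -/
noncomputable def word (K : Type*) [Field K] (L : List PTree) : Words K :=
  MonoidAlgebra.of K _ (FreeMonoid.ofList L)

theorem word_append (L L' : List PTree) : word K (L ++ L') = word K L * word K L' := by
  rw [word, FreeMonoid.ofList_append, map_mul, word, word]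

theorem word_nil : word K [] = 1 := by
  rw [word, FreeMonoid.ofList_nil, map_one]

theorem word_cons (t : PTree) (L : List PTree) : word K (t :: L) = word K [t] * word K L := by
  rw [← word_append, List.singleton_append]

theorem induction_word {p : Words K → Prop} (x : Words K) (hw : ∀ L, p (word K L))
    (hadd : ∀ x y, p x → p y → p (x + y)) (hsmul : ∀ (c : K) x, p x → p (c • x)) : p x :=
  MonoidAlgebra.induction_on x (fun L => hw (FreeMonoid.toList L)) hadd hsmul

/-- The words of length one, as a linear map. -/
noncomputable def letter (K : Type*) [Field K] : GroveAlgebra K →ₗ[K] Words K :=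
  Finsupp.linearCombination K fun t => word K [t]

theorem letter_X (t : PTree) : letter K (X K t) = word K [t] := by simp [letter, X]

/-- The grafting of the letters of a word; it is zero if there are fewer than two letters. -/
noncomputable def graftList (K : Type*) [Field K] : List PTree → GroveAlgebra K
  | l :: s :: L => X K (node l (s :: L).dropLast ((s :: L).getLast (by simp)))
  | _ => 0

theorem graftList_cons_append (l : PTree) (mid : List PTree) (r : PTree) :
    graftList K (l :: (mid ++ [r])) = X K (node l mid r) := by
  cases mid with
  | nil => simp [graftList]
  | cons s mid =>
    rw [List.cons_append, graftList]
    simp only [← List.cons_append, List.dropLast_concat, List.getLast_append_singleton]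

/-- The linear map sending a word to the grafting of its letters. -/
noncomputable def graftWord (K : Type*) [Field K] : Words K →ₗ[K] GroveAlgebra K :=
  (Finsupp.linearCombination K fun L : FreeMonoid PTree => graftList K L.toList) ∘ₗ
    (MonoidAlgebra.coeffLinearEquiv K).toLinearMap

theorem graftWord_word (L : List PTree) : graftWord K (word K L) = graftList K L := by
  simp [graftWord, word]

/-- Words with fewer than two letters graft to zero and the others to nodes. This kills the
correction term of `tensorOp` on graftings. -/
theorem aug_graftWord (w : Words K) : (triData K).aug (graftWord K w) = 0 := by
  induction w using induction_word with
  | hw L =>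
    rw [graftWord_word]
    rcases L with _ | ⟨_, _ | _⟩ <;> simp [graftList, aug_X_node]
  | hadd x y hx hy => simp [hx, hy]
  | hsmul c x hx => simp [hx]

/-- The trilinear extension of the grafting `(l, mid, r) ↦ l ∨ mid ∨ r`. -/
noncomputable def nodeL (l : GroveAlgebra K) (w : Words K) (r : GroveAlgebra K) : GroveAlgebra K :=
  graftWord K (letter K l * w * letter K r)

theorem nodeL_X (l : PTree) (mid : List PTree) (r : PTree) :
    nodeL (X K l) (word K mid) (X K r) = X K (node l mid r) := by
  rw [nodeL, letter_X, letter_X, ← word_append, ← word_append, graftWord_word, List.append_assoc,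
    List.singleton_append, graftList_cons_append]

theorem aug_nodeL (l : GroveAlgebra K) (w : Words K) (r : GroveAlgebra K) :
    (triData K).aug (nodeL l w r) = 0 := aug_graftWord _

theorem nodeL_XGrove_right (l : PTree) (mid : List PTree) (s : Finset PTree) :
    nodeL (X K l) (word K mid) (XGrove K s) = XGrove K (s.image fun u => node l mid u) := by
  rw [XGrove_image fun _ _ h => by injection h]
  simp only [XGrove, ← nodeL_X]
  simp [nodeL, Finset.mul_sum]

theorem nodeL_XGrove_left (s : Finset PTree) (mid : List PTree) (r : PTree) :
    nodeL (XGrove K s) (word K mid) (X K r) = XGrove K (s.image fun u => node u mid r) := by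
  rw [XGrove_image fun _ _ h => by injection h]
  simp only [XGrove, ← nodeL_X]
  simp [nodeL, Finset.sum_mul]

theorem nodeL_XGrove_mid (l : PTree) (mid mid' : List PTree) (r : PTree) (s : Finset PTree) :
    nodeL (X K l) (word K mid * letter K (XGrove K s) * word K mid') (X K r) =
      XGrove K (s.image fun u => node l (mid ++ u :: mid') r) := by
  rw [XGrove_image fun _ _ h => by simpa using h]
  simp only [XGrove, ← nodeL_X, word_append, word_cons _ mid', ← letter_X]
  simp [nodeL, Finset.sum_mul, Finset.mul_sum, mul_assoc]

/-- Both sides are multilinear and agree on trees by definition of `⊣`. No restriction on `z` is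
needed: `r ⋆ 1 = r` matches `x ≺ 1 = x`. -/
theorem prec_nodeL (l : GroveAlgebra K) (w : Words K) (r z : GroveAlgebra K) :
    (triData K).prec (nodeL l w r) z = nodeL l w ((triData K).star r z) := by
  induction l using induction_X with
  | hadd x y hx hy => simp_all [nodeL, add_mul]
  | hsmul c x hx => simp_all [nodeL]
  | hX l =>
  induction w using induction_word with
  | hadd x y hx hy => simp_all [nodeL, add_mul, mul_add]
  | hsmul c x hx => simp_all [nodeL]
  | hw mid =>
  induction r using induction_X with
  | hadd x y hx hy => simp_all [nodeL, mul_add]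
  | hsmul c x hx => simp_all [nodeL]
  | hX r =>
  induction z using induction_X with
  | hadd x y hx hy => simp_all [nodeL, mul_add]
  | hsmul c x hx => simp_all [nodeL]
  | hX z =>
  rw [star_X_X, nodeL_X, nodeL_XGrove_right]
  exact groveOp_X_X _ _ _

theorem succ_nodeL (z l : GroveAlgebra K) (w : Words K) (r : GroveAlgebra K) :
    (triData K).succ z (nodeL l w r) = nodeL ((triData K).star z l) w r := by
  induction l using induction_X with
  | hadd x y hx hy => simp_all [nodeL, add_mul]
  | hsmul c x hx => simp_all [nodeL]
  | hX l =>
  induction w using induction_word with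
  | hadd x y hx hy => simp_all [nodeL, add_mul, mul_add]
  | hsmul c x hx => simp_all [nodeL]
  | hw mid =>
  induction r using induction_X with
  | hadd x y hx hy => simp_all [nodeL, mul_add]
  | hsmul c x hx => simp_all [nodeL]
  | hX r =>
  induction z using induction_X with
  | hadd x y hx hy => simp_all [nodeL, add_mul]
  | hsmul c x hx => simp_all [nodeL]
  | hX z =>
  rw [star_X_X, nodeL_X, nodeL_XGrove_left]
  exact groveOp_X_X _ _ _

/-- The two roots merge: the words are concatenated and only the two neighbouring branches interact.
-/
theorem bullet_nodeL (l : GroveAlgebra K) (w : Words K) (r l' : GroveAlgebra K) (w' : Words K)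
    (r' : GroveAlgebra K) : (triData K).bullet (nodeL l w r) (nodeL l' w' r') =
      nodeL l (w * letter K ((triData K).star r l') * w') r' := by
  induction l using induction_X with
  | hadd x y hx hy => simp_all [nodeL, add_mul]
  | hsmul c x hx => simp_all [nodeL]
  | hX l =>
  induction w using induction_word with
  | hadd x y hx hy => simp_all [nodeL, add_mul, mul_add]
  | hsmul c x hx => simp_all [nodeL]
  | hw mid =>
  induction r using induction_X with
  | hadd x y hx hy => simp_all [nodeL, mul_add, add_mul]
  | hsmul c x hx => simp_all [nodeL]
  | hX r =>
  induction l' using induction_X with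
  | hadd x y hx hy => simp_all [nodeL, add_mul, mul_add]
  | hsmul c x hx => simp_all [nodeL]
  | hX l' =>
  induction w' using induction_word with
  | hadd x y hx hy => simp_all [nodeL, add_mul, mul_add]
  | hsmul c x hx => simp_all [nodeL]
  | hw mid' =>
  induction r' using induction_X with
  | hadd x y hx hy => simp_all [nodeL, mul_add]
  | hsmul c x hx => simp_all [nodeL]
  | hX r' =>
  rw [star_X_X, nodeL_X, nodeL_X, nodeL_XGrove_mid]
  exact groveOp_X_X _ _ _

end GroveAlgebra

/-! ### Unit laws and the axioms for individual triples -/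

namespace TriData

variable {K A : Type*} [CommRing K] [AddCommGroup A] [Module K A]

/-- The unit laws of an augmented dendriform trialgebra with the normalisation `1 ∘ 1 = 0`, stated
for all elements. -/
structure UnitLaws (D : TriData K A) : Prop where
  aug_one : D.aug D.one = 1
  aug_prec : ∀ x y, D.aug (D.prec x y) = 0
  aug_succ : ∀ x y, D.aug (D.succ x y) = 0
  aug_bullet : ∀ x y, D.aug (D.bullet x y) = 0
  one_prec : ∀ x, D.prec D.one x = 0
  prec_one : ∀ x, D.prec x D.one = x - D.aug x • D.one
  one_succ : ∀ x, D.succ D.one x = x - D.aug x • D.one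
  succ_one : ∀ x, D.succ x D.one = 0
  one_bullet : ∀ x, D.bullet D.one x = 0
  bullet_one : ∀ x, D.bullet x D.one = 0

/-- The axioms of a dendriform trialgebra for three given elements. -/
structure TriAxioms (D : TriData K A) (x y z : A) : Prop where
  prec_prec : D.prec (D.prec x y) z = D.prec x (D.star y z)
  succ_prec : D.prec (D.succ x y) z = D.succ x (D.prec y z)
  star_succ : D.succ (D.star x y) z = D.succ x (D.succ y z)
  succ_bullet : D.bullet (D.succ x y) z = D.succ x (D.bullet y z)
  prec_bullet : D.bullet (D.prec x y) z = D.bullet x (D.succ y z)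
  bullet_prec : D.prec (D.bullet x y) z = D.bullet x (D.prec y z)
  bullet_bullet : D.bullet (D.bullet x y) z = D.bullet x (D.bullet y z)

namespace UnitLaws

variable {D : TriData K A} (h : D.UnitLaws)

include h

theorem aug_star (x y : A) : D.aug (D.star x y) = D.aug x * D.aug y := by
  simp [star_apply, h.aug_one, h.aug_prec, h.aug_succ, h.aug_bullet]

theorem one_star (x : A) : D.star D.one x = x := by
  simp [star_apply, h.one_prec, h.one_succ, h.one_bullet, h.aug_one]

theorem star_one (x : A) : D.star x D.one = x := by
  simp [star_apply, h.prec_one, h.succ_one, h.bullet_one, h.aug_one]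

/-- The sum of the seven axioms and the unit parts. Only the axioms for this one triple are used, so
the lemma can serve inside an induction that proves the axioms. -/
theorem star_assoc {x y z : A} (a : D.TriAxioms x y z) :
    D.star (D.star x y) z = D.star x (D.star y z) := by
  have h₁ : D.prec (D.star x y) z =
      D.prec x (D.star y z) + D.succ x (D.prec y z) + D.bullet x (D.prec y z) := by
    rw [star_apply D x y]
    simp [h.one_prec, a.prec_prec, a.succ_prec, a.bullet_prec]
  have h₂ : D.bullet (D.star x y) z =
      D.bullet x (D.succ y z) + D.succ x (D.bullet y z) + D.bullet x (D.bullet y z) := by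
    rw [star_apply D x y]
    simp [h.one_bullet, a.prec_bullet, a.succ_bullet, a.bullet_bullet]
  rw [star_apply D (D.star x y), star_apply D x (D.star y z), h₁, h₂, a.star_succ, h.aug_star,
    h.aug_star]
  have h₃ : D.succ x (D.star y z) =
      D.succ x (D.prec y z) + D.succ x (D.succ y z) + D.succ x (D.bullet y z) := by
    rw [star_apply D y z]
    simp [h.succ_one]
  have h₄ : D.bullet x (D.star y z) =
      D.bullet x (D.prec y z) + D.bullet x (D.succ y z) + D.bullet x (D.bullet y z) := by
    rw [star_apply D y z]
    simp [h.bullet_one]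
  rw [h₃, h₄, mul_assoc]
  abel

/-- With the normalisation `1 ∘ 1 = 0` the axioms persist when an argument is the unit. Hence the
augmentation hypotheses can be dropped, and linearity in each argument is available on the whole
space. -/
theorem triAxioms_one_left (y z : A) : D.TriAxioms D.one y z := by
  constructor <;>
    simp [h.one_prec, h.one_succ, h.one_bullet, h.one_star, h.aug_prec, h.aug_succ, h.aug_bullet]

theorem triAxioms_one_mid (x z : A) : D.TriAxioms x D.one z := by
  constructor <;>
    simp [h.one_prec, h.one_succ, h.one_bullet, h.one_star, h.prec_one, h.succ_one, h.bullet_one,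
      h.star_one]

theorem triAxioms_one_right (x y : A) : D.TriAxioms x y D.one := by
  constructor <;>
    simp [h.prec_one, h.succ_one, h.bullet_one, h.star_one, h.aug_prec, h.aug_succ, h.aug_bullet]

end UnitLaws

theorem TriAxioms.add_left {D : TriData K A} {x x' y z : A} (a : D.TriAxioms x y z)
    (b : D.TriAxioms x' y z) : D.TriAxioms (x + x') y z := by
  constructor <;> simp only [map_add, LinearMap.add_apply]
  · rw [a.prec_prec, b.prec_prec]
  · rw [a.succ_prec, b.succ_prec]
  · rw [a.star_succ, b.star_succ]
  · rw [a.succ_bullet, b.succ_bullet]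
  · rw [a.prec_bullet, b.prec_bullet]
  · rw [a.bullet_prec, b.bullet_prec]
  · rw [a.bullet_bullet, b.bullet_bullet]

theorem TriAxioms.add_mid {D : TriData K A} {x y y' z : A} (a : D.TriAxioms x y z)
    (b : D.TriAxioms x y' z) : D.TriAxioms x (y + y') z := by
  constructor <;> simp only [map_add, LinearMap.add_apply]
  · rw [a.prec_prec, b.prec_prec]
  · rw [a.succ_prec, b.succ_prec]
  · rw [a.star_succ, b.star_succ]
  · rw [a.succ_bullet, b.succ_bullet]
  · rw [a.prec_bullet, b.prec_bullet]
  · rw [a.bullet_prec, b.bullet_prec]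
  · rw [a.bullet_bullet, b.bullet_bullet]

theorem TriAxioms.add_right {D : TriData K A} {x y z z' : A} (a : D.TriAxioms x y z)
    (b : D.TriAxioms x y z') : D.TriAxioms x y (z + z') := by
  constructor <;> simp only [map_add]
  · rw [a.prec_prec, b.prec_prec]
  · rw [a.succ_prec, b.succ_prec]
  · rw [a.star_succ, b.star_succ]
  · rw [a.succ_bullet, b.succ_bullet]
  · rw [a.prec_bullet, b.prec_bullet]
  · rw [a.bullet_prec, b.bullet_prec]
  · rw [a.bullet_bullet, b.bullet_bullet]

theorem TriAxioms.smul {D : TriData K A} {x y z : A} (a : D.TriAxioms x y z) (c d e : K) :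
    D.TriAxioms (c • x) (d • y) (e • z) := by
  constructor <;> simp only [map_smul, LinearMap.smul_apply]
  · rw [a.prec_prec]
  · rw [a.succ_prec]
  · rw [a.star_succ]
  · rw [a.succ_bullet]
  · rw [a.prec_bullet]
  · rw [a.bullet_prec]
  · rw [a.bullet_bullet]

theorem UnitLaws.isAugTrialgebra {D : TriData K A} (h : D.UnitLaws)
    (a : ∀ x y z, D.TriAxioms x y z) : D.IsAugTrialgebra where
  aug_one := h.aug_one
  aug_prec := h.aug_prec
  aug_succ := h.aug_succ
  aug_bullet := h.aug_bullet
  one_prec_one := h.one_prec _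
  one_succ_one := h.succ_one _
  one_bullet_one := h.one_bullet _
  one_prec x _ := h.one_prec x
  prec_one x hx := by simp [h.prec_one, hx]
  one_succ x hx := by simp [h.one_succ, hx]
  succ_one x _ := h.succ_one x
  one_bullet x _ := h.one_bullet x
  bullet_one x _ := h.bullet_one x
  prec_prec x y z _ _ _ := (a x y z).prec_prec
  succ_prec x y z _ _ _ := (a x y z).succ_prec
  star_succ x y z _ _ _ := (a x y z).star_succ
  succ_bullet x y z _ _ _ := (a x y z).succ_bullet
  prec_bullet x y z _ _ _ := (a x y z).prec_bullet
  bullet_prec x y z _ _ _ := (a x y z).bullet_prec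
  bullet_bullet x y z _ _ _ := (a x y z).bullet_bullet

/-! ### The tensor square -/

theorem tensor_prec (D : TriData K A) : D.tensor.prec = D.tensorOp D.prec := rfl

theorem tensor_succ (D : TriData K A) : D.tensor.succ = D.tensorOp D.succ := rfl

theorem tensor_bullet (D : TriData K A) : D.tensor.bullet = D.tensorOp D.bullet := rfl

theorem tensor_one (D : TriData K A) : D.tensor.one = D.one ⊗ₜ D.one := rfl

theorem tensor_aug_tmul (D : TriData K A) (a b : A) :
    D.tensor.aug (a ⊗ₜ b) = D.aug a * D.aug b := by
  simp [tensor]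

/-- The three correction terms and the unit part of the tensor square add up to `(a ⋆ a') ⊗ ε(b)
ε(b') 1`, exactly the unit part that completes the second factor to `b ⋆ b'`. -/
theorem tensor_star_tmul (D : TriData K A) (a b a' b' : A) :
    D.tensor.star (a ⊗ₜ b) (a' ⊗ₜ b') = D.star a a' ⊗ₜ D.star b b' := by
  rw [star_apply, tensor_prec, tensor_succ, tensor_bullet, tensorOp_tmul, tensorOp_tmul,
    tensorOp_tmul, tensor_aug_tmul, tensor_aug_tmul, tensor_one, star_apply D b b']
  have : D.star a a' ⊗ₜ[K] ((D.aug b * D.aug b') • D.one) =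
      (D.prec a a' + D.succ a a' + D.bullet a a') ⊗ₜ[K] (D.aug b • D.aug b' • D.one) +
        (D.aug a * D.aug b * (D.aug a' * D.aug b')) • (D.one ⊗ₜ[K] D.one) := by
    rw [star_apply D a a', TensorProduct.add_tmul _ ((D.aug a * D.aug a') • D.one), smul_smul,
      TensorProduct.smul_tmul_smul]
    congr 2
    ring
  rw [TensorProduct.tmul_add, this]
  simp only [TensorProduct.tmul_add, TensorProduct.add_tmul]
  abel

theorem UnitLaws.tensor {D : TriData K A} (h : D.UnitLaws) : D.tensor.UnitLaws where
  aug_one := by simp [tensor_one, tensor_aug_tmul, h.aug_one]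
  aug_prec x y := by
    induction x with
    | zero => simp
    | add x x' hx hx' => simp [hx, hx']
    | tmul a b =>
    induction y with
    | zero => simp
    | add y y' hy hy' => simp [hy, hy']
    | tmul a' b' => simp [tensor_prec, tensorOp_tmul, tensor_aug_tmul, h.aug_prec]
  aug_succ x y := by
    induction x with
    | zero => simp
    | add x x' hx hx' => simp [hx, hx']
    | tmul a b =>
    induction y with
    | zero => simp
    | add y y' hy hy' => simp [hy, hy']
    | tmul a' b' => simp [tensor_succ, tensorOp_tmul, tensor_aug_tmul, h.aug_succ]
  aug_bullet x y := by
    induction x with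
    | zero => simp
    | add x x' hx hx' => simp [hx, hx']
    | tmul a b =>
    induction y with
    | zero => simp
    | add y y' hy hy' => simp [hy, hy']
    | tmul a' b' => simp [tensor_bullet, tensorOp_tmul, tensor_aug_tmul, h.aug_bullet]
  one_prec x := by
    induction x with
    | zero => simp
    | add x y hx hy => simp [hx, hy]
    | tmul a b => simp [tensor_prec, tensor_one, tensorOp_tmul, h.one_prec]
  prec_one x := by
    induction x with
    | zero => simp
    | add x y hx hy => simp [hx, hy, add_smul]; abel
    | tmul a b =>
      simp [tensor_prec, tensor_one, tensorOp_tmul, tensor_aug_tmul, h.prec_one, h.star_one,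
        h.aug_one, TensorProduct.tmul_sub, TensorProduct.sub_tmul, TensorProduct.smul_tmul,
        mul_smul]
      module
  one_succ x := by
    induction x with
    | zero => simp
    | add x y hx hy => simp [hx, hy, add_smul]; abel
    | tmul a b =>
      simp [tensor_succ, tensor_one, tensorOp_tmul, tensor_aug_tmul, h.one_succ, h.one_star,
        h.aug_one, TensorProduct.tmul_sub, TensorProduct.sub_tmul, TensorProduct.smul_tmul,
        mul_smul]
      module
  succ_one x := by
    induction x with
    | zero => simp
    | add x y hx hy => simp [hx, hy]
    | tmul a b => simp [tensor_succ, tensor_one, tensorOp_tmul, h.succ_one]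
  one_bullet x := by
    induction x with
    | zero => simp
    | add x y hx hy => simp [hx, hy]
    | tmul a b => simp [tensor_bullet, tensor_one, tensorOp_tmul, h.one_bullet]
  bullet_one x := by
    induction x with
    | zero => simp
    | add x y hx hy => simp [hx, hy]
    | tmul a b => simp [tensor_bullet, tensor_one, tensorOp_tmul, h.bullet_one]

/-- In the main terms the second factors satisfy the axiom and the first factors need only
associativity of `⋆`; in the correction terms the first factors satisfy the axiom and the second are
multiples of the unit. -/
theorem triAxioms_tmul {D : TriData K A} (h : D.UnitLaws) (a : ∀ x y z, D.TriAxioms x y z)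
    (x x' y y' z z' : A) : D.tensor.TriAxioms (x ⊗ₜ x') (y ⊗ₜ y') (z ⊗ₜ z') where
  prec_prec := by
    rw [tensor_star_tmul]
    simp [tensor_prec, tensorOp_tmul, h.aug_one, h.aug_prec, h.one_prec, h.aug_star,
      (a _ _ _).prec_prec, h.star_assoc (a _ _ _), mul_smul]
  succ_prec := by
    simp [tensor_prec, tensor_succ, tensorOp_tmul, h.aug_one, h.aug_prec, h.aug_succ,
      h.one_prec, h.succ_one,
      (a _ _ _).succ_prec, h.star_assoc (a _ _ _)]
    module
  star_succ := by
    rw [tensor_star_tmul]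
    simp [tensor_succ, tensorOp_tmul, h.aug_one, h.aug_succ, h.succ_one, h.aug_star,
      (a _ _ _).star_succ, h.star_assoc (a _ _ _), mul_smul]
    module
  succ_bullet := by
    simp [tensor_bullet, tensor_succ, tensorOp_tmul, h.aug_one, h.aug_bullet, h.aug_succ,
      h.one_bullet,
      h.succ_one, (a _ _ _).succ_bullet, h.star_assoc (a _ _ _)]
    module
  prec_bullet := by
    simp [tensor_bullet, tensor_succ, tensor_prec, tensorOp_tmul, h.aug_one, h.aug_prec, h.aug_succ,
      h.one_bullet, h.bullet_one, (a _ _ _).prec_bullet, h.star_assoc (a _ _ _)]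
    module
  bullet_prec := by
    simp [tensor_bullet, tensor_prec, tensorOp_tmul, h.aug_one, h.aug_prec, h.aug_bullet,
      h.one_prec, h.bullet_one, (a _ _ _).bullet_prec, h.star_assoc (a _ _ _)]
    module
  bullet_bullet := by
    simp [tensor_bullet, tensorOp_tmul, h.aug_one, h.aug_bullet,
      h.one_bullet, h.bullet_one, (a _ _ _).bullet_bullet, h.star_assoc (a _ _ _)]
    module

theorem triAxioms_tensor {D : TriData K A} (h : D.UnitLaws) (a : ∀ x y z, D.TriAxioms x y z)
    (x y z : A ⊗[K] A) : D.tensor.TriAxioms x y z := by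
  induction x with
  -- Zero is treated as `0 • 1`, since the axioms are known for the unit and stable under scaling.
  | zero => simpa using (h.tensor.triAxioms_one_left y z).smul 0 1 1
  | add x x' hx hx' => exact hx.add_left hx'
  | tmul x x' =>
  induction y with
  | zero => simpa using (h.tensor.triAxioms_one_mid (x ⊗ₜ x') z).smul 1 0 1
  | add y y' hy hy' => exact hy.add_mid hy'
  | tmul y y' =>
  induction z with
  | zero => simpa using (h.tensor.triAxioms_one_right (x ⊗ₜ x') (y ⊗ₜ y')).smul 1 1 0
  | add z z' hz hz' => exact hz.add_right hz'
  | tmul z z' => exact triAxioms_tmul h a x x' y y' z z'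

end TriData

/-! ### The grove algebra is an augmented dendriform trialgebra -/

namespace GroveAlgebra

variable {K : Type*} [Field K]

open PTree

theorem one_eq : (triData K).one = X K leaf := rfl

theorem unitLaws : (triData K).UnitLaws where
  aug_one := aug_X_leaf
  aug_prec x y := by
    induction x using induction_X with
    | hadd x x' hx hx' => simp [hx, hx']
    | hsmul c x hx => simp [hx]
    | hX t =>
    induction y using induction_X with
    | hadd x x' hx hx' => simp [hx, hx']
    | hsmul c x hx => simp [hx]
    | hX z =>
    cases t with
    | leaf => simp [prec_X_X, dashv, XGrove]
    | node l mid r => rw [← nodeL_X, prec_nodeL, aug_nodeL]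
  aug_succ x y := by
    induction x using induction_X with
    | hadd x x' hx hx' => simp [hx, hx']
    | hsmul c x hx => simp [hx]
    | hX t =>
    induction y using induction_X with
    | hadd x x' hx hx' => simp [hx, hx']
    | hsmul c x hx => simp [hx]
    | hX z =>
    cases z with
    | leaf => simp [succ_X_X, vdash, XGrove]
    | node l mid r => rw [← nodeL_X, succ_nodeL, aug_nodeL]
  aug_bullet x y := by
    induction x using induction_X with
    | hadd x x' hx hx' => simp [hx, hx']
    | hsmul c x hx => simp [hx]
    | hX t =>
    induction y using induction_X with
    | hadd x x' hx hx' => simp [hx, hx']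
    | hsmul c x hx => simp [hx]
    | hX z =>
    cases t with
    | leaf => simp [bullet_X_X, perp, XGrove]
    | node l mid r =>
    cases z with
    | leaf => simp [bullet_X_X, perp, XGrove]
    | node l' mid' r' => rw [← nodeL_X, ← nodeL_X, bullet_nodeL, aug_nodeL]
  one_prec x := by
    induction x using induction_X with
    | hadd x y hx hy => simp [hx, hy]
    | hsmul c x hx => simp [hx]
    | hX t => simp [one_eq, prec_X_X, dashv, XGrove]
  prec_one x := by
    induction x using induction_X with
    | hadd x y hx hy => simp [hx, hy, add_smul]; abel
    | hsmul c x hx => simp [hx, smul_sub, mul_smul]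
    | hX t => cases t <;> simp [one_eq, prec_X_X, dashv, XGrove, aug_X_leaf, aug_X_node]
  one_succ x := by
    induction x using induction_X with
    | hadd x y hx hy => simp [hx, hy, add_smul]; abel
    | hsmul c x hx => simp [hx, smul_sub, mul_smul]
    | hX t => cases t <;> simp [one_eq, succ_X_X, vdash, XGrove, aug_X_leaf, aug_X_node]
  succ_one x := by
    induction x using induction_X with
    | hadd x y hx hy => simp [hx, hy]
    | hsmul c x hx => simp [hx]
    | hX t => simp [one_eq, succ_X_X, vdash, XGrove]
  one_bullet x := by
    induction x using induction_X with
    | hadd x y hx hy => simp [hx, hy]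
    | hsmul c x hx => simp [hx]
    | hX t => simp [one_eq, bullet_X_X, perp, XGrove]
  bullet_one x := by
    induction x using induction_X with
    | hadd x y hx hy => simp [hx, hy]
    | hsmul c x hx => simp [hx]
    | hX t => cases t <;> simp [one_eq, bullet_X_X, perp, XGrove]

/-- Induction on total degree. For three nodes, only three axioms need associativity, for the
smaller triples `(r, z, w)`, `(t, z, l'')` and `(r, z, l'')`. In the other four the two products act
at separate places of the word, and the rules for `nodeL` suffice. -/
theorem triAxioms_X (t z w : PTree) : (triData K).TriAxioms (X K t) (X K z) (X K w) := by
  induction hn : t.deg + z.deg + w.deg using Nat.strong_induction_on generalizing t z w with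
  | _ n ih =>
  rcases t with _ | ⟨l, mid, r⟩
  · exact unitLaws.triAxioms_one_left _ _
  rcases z with _ | ⟨l', mid', r'⟩
  · exact unitLaws.triAxioms_one_mid _ _
  rcases w with _ | ⟨l'', mid'', r''⟩
  · exact unitLaws.triAxioms_one_right _ _
  simp only [deg_node] at hn
  have h₁ := unitLaws.star_assoc
    (ih _ (by simp only [deg_node]; omega) r (node l' mid' r') (node l'' mid'' r'') rfl)
  have h₂ := unitLaws.star_assoc
    (ih _ (by simp only [deg_node]; omega) (node l mid r) (node l' mid' r') l'' rfl)
  have h₃ := unitLaws.star_assoc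
    (ih _ (by simp only [deg_node]; omega) r (node l' mid' r') l'' rfl)
  constructor
  · rw [← nodeL_X l, prec_nodeL, prec_nodeL, prec_nodeL, h₁]
  · rw [← nodeL_X l', succ_nodeL, prec_nodeL, prec_nodeL, succ_nodeL]
  · rw [← nodeL_X l'', succ_nodeL, succ_nodeL, succ_nodeL, h₂]
  · rw [← nodeL_X l', ← nodeL_X l'', succ_nodeL, bullet_nodeL, bullet_nodeL, succ_nodeL]
  · rw [← nodeL_X l, ← nodeL_X l'', prec_nodeL, bullet_nodeL, succ_nodeL, bullet_nodeL, h₃]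
  · rw [← nodeL_X l, ← nodeL_X l', bullet_nodeL, prec_nodeL, prec_nodeL, bullet_nodeL]
  · rw [← nodeL_X l, ← nodeL_X l', ← nodeL_X l'', bullet_nodeL, bullet_nodeL, bullet_nodeL,
      bullet_nodeL]
    simp only [mul_assoc]

theorem triAxioms (x y z : GroveAlgebra K) : (triData K).TriAxioms x y z := by
  induction x using induction_X with
  | hadd x x' hx hx' => exact hx.add_left hx'
  | hsmul c x hx => simpa using hx.smul c 1 1
  | hX t =>
  induction y using induction_X with
  | hadd x x' hx hx' => exact hx.add_mid hx'
  | hsmul c x hx => simpa using hx.smul 1 c 1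
  | hX t =>
  induction z using induction_X with
  | hadd x x' hx hx' => exact hx.add_right hx'
  | hsmul c x hx => simpa using hx.smul 1 1 c
  | hX t => exact triAxioms_X _ _ _

theorem star_assoc (x y z : GroveAlgebra K) : (triData K).star ((triData K).star x y) z =
    (triData K).star x ((triData K).star y z) :=
  unitLaws.star_assoc (triAxioms x y z)

end GroveAlgebra

/-! ### The star algebra

The pointwise product of finitely supported functions is disabled in favour of `⋆`. -/

attribute [-instance] Finsupp.instMul Finsupp.instMulZeroClass Finsupp.instSemigroupWithZero
  Finsupp.instNonUnitalNonAssocSemiring Finsupp.instNonUnitalSemiring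
  Finsupp.instNonUnitalCommSemiring Finsupp.instNonUnitalNonAssocRing Finsupp.instNonUnitalRing
  Finsupp.instNonUnitalCommRing

namespace GroveAlgebra

variable {K : Type*} [Field K]

open PTree

/-- The product `⋆` makes the grove algebra a ring. -/
noncomputable instance instRing : Ring (GroveAlgebra K) :=
  { (inferInstance : AddCommGroup (GroveAlgebra K)) with
    mul := fun x y => (triData K).star x y
    one := X K leaf
    left_distrib := fun x y z => map_add ((triData K).star x) y z
    right_distrib := fun x y z => LinearMap.map_add₂ (triData K).star x y z
    zero_mul := fun x => LinearMap.map_zero₂ (triData K).star x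
    mul_zero := fun x => map_zero ((triData K).star x)
    mul_assoc := star_assoc
    one_mul := unitLaws.one_star
    mul_one := unitLaws.star_one }

noncomputable instance instAlgebra : Algebra K (GroveAlgebra K) :=
  Algebra.ofModule (fun c x y => LinearMap.map_smul₂ (triData K).star c x y)
    (fun c x y => map_smul ((triData K).star x) c y)

theorem mul_def (x y : GroveAlgebra K) : x * y = (triData K).star x y := rfl

theorem one_def : (1 : GroveAlgebra K) = (triData K).one := rfl

/-- Identifies the dendriform `⋆` of the tensor square with the tensor product of algebras, so that
compatibility of Δ with `⋆` says that Δ is an algebra morphism. -/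
theorem tensor_star_eq_mul (x y : GroveAlgebra K ⊗[K] GroveAlgebra K) :
    (triData K).tensor.star x y = x * y := by
  induction x with
  | zero => simp
  | add x x' hx hx' => simp [hx, hx', add_mul]
  | tmul a b =>
  induction y with
  | zero => simp
  | add y y' hy hy' => simp [hy, hy', mul_add]
  | tmul a' b' => rw [TriData.tensor_star_tmul, Algebra.TensorProduct.tmul_mul_tmul]; rfl

/-! ### Grafting with coefficients in an algebra -/

section Coefficients

variable {A : Type*} [Ring A] [Algebra K A]

/-- The extension of `letter` to coefficients in an algebra. -/
noncomputable def letterT : A ⊗[K] GroveAlgebra K →ₗ[K] A ⊗[K] Words K := (letter K).lTensor A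

/-- The extension of `graftWord` to coefficients in an algebra. -/
noncomputable def graftT : A ⊗[K] Words K →ₗ[K] A ⊗[K] GroveAlgebra K := (graftWord K).lTensor A

/-- The extension of `nodeL` to coefficients in an algebra. -/
noncomputable def nodeT (l : A ⊗[K] GroveAlgebra K) (w : A ⊗[K] Words K)
    (r : A ⊗[K] GroveAlgebra K) : A ⊗[K] GroveAlgebra K :=
  graftT (letterT l * w * letterT r)

@[simp] theorem letterT_tmul (a : A) (x : GroveAlgebra K) :
    letterT (a ⊗ₜ[K] x) = a ⊗ₜ letter K x := rfl

@[simp] theorem graftT_tmul (a : A) (w : Words K) :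
    graftT (a ⊗ₜ[K] w) = a ⊗ₜ graftWord K w := rfl

theorem nodeT_tmul (a b c : A) (l : GroveAlgebra K) (w : Words K) (r : GroveAlgebra K) :
    nodeT (a ⊗ₜ[K] l) (b ⊗ₜ[K] w) (c ⊗ₜ[K] r) = (a * b * c) ⊗ₜ nodeL l w r := by
  simp [nodeT, nodeL]

end Coefficients

/-- The rule `prec_nodeL` holds in the second tensor factor, while associativity regroups the
coefficients in the first; the correction term vanishes because graftings have augmentation zero. -/
theorem tensor_prec_nodeT (l : GroveAlgebra K ⊗[K] GroveAlgebra K)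
    (w : GroveAlgebra K ⊗[K] Words K) (r z : GroveAlgebra K ⊗[K] GroveAlgebra K) :
    (triData K).tensor.prec (nodeT l w r) z = nodeT l w (r * z) := by
  induction l with
  | zero => simp [nodeT]
  | add x y hx hy => simp_all [nodeT, add_mul]
  | tmul a l =>
  induction w with
  | zero => simp [nodeT]
  | add x y hx hy => simp_all [nodeT, add_mul, mul_add]
  | tmul b w =>
  induction r with
  | zero => simp [nodeT]
  | add x y hx hy => simp_all [nodeT, add_mul, mul_add]
  | tmul c r =>
  induction z with
  | zero => simp [nodeT]
  | add x y hx hy => simp_all [nodeT, mul_add]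
  | tmul d z =>
  rw [Algebra.TensorProduct.tmul_mul_tmul, nodeT_tmul, nodeT_tmul, TriData.tensor_prec,
    TriData.tensorOp_tmul, aug_nodeL, prec_nodeL, zero_smul, TensorProduct.tmul_zero, add_zero,
    ← mul_def, ← mul_def, mul_assoc]

theorem tensor_succ_nodeT (z l : GroveAlgebra K ⊗[K] GroveAlgebra K)
    (w : GroveAlgebra K ⊗[K] Words K) (r : GroveAlgebra K ⊗[K] GroveAlgebra K) :
    (triData K).tensor.succ z (nodeT l w r) = nodeT (z * l) w r := by
  induction l with
  | zero => simp [nodeT]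
  | add x y hx hy => simp_all [nodeT, add_mul, mul_add]
  | tmul a l =>
  induction w with
  | zero => simp [nodeT]
  | add x y hx hy => simp_all [nodeT, add_mul, mul_add]
  | tmul b w =>
  induction r with
  | zero => simp [nodeT]
  | add x y hx hy => simp_all [nodeT, mul_add]
  | tmul c r =>
  induction z with
  | zero => simp [nodeT]
  | add x y hx hy => simp_all [nodeT, add_mul]
  | tmul d z =>
  rw [Algebra.TensorProduct.tmul_mul_tmul, nodeT_tmul, nodeT_tmul, TriData.tensor_succ,
    TriData.tensorOp_tmul, aug_nodeL, succ_nodeL, zero_smul, smul_zero, TensorProduct.tmul_zero,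
    add_zero, ← mul_def, ← mul_def]
  simp only [mul_assoc]

theorem tensor_bullet_nodeT (l : GroveAlgebra K ⊗[K] GroveAlgebra K)
    (w : GroveAlgebra K ⊗[K] Words K) (r l' : GroveAlgebra K ⊗[K] GroveAlgebra K)
    (w' : GroveAlgebra K ⊗[K] Words K) (r' : GroveAlgebra K ⊗[K] GroveAlgebra K) :
    (triData K).tensor.bullet (nodeT l w r) (nodeT l' w' r') =
      nodeT l (w * letterT (r * l') * w') r' := by
  induction l with
  | zero => simp [nodeT]
  | add x y hx hy => simp_all [nodeT, add_mul]
  | tmul a l =>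
  induction w with
  | zero => simp [nodeT]
  | add x y hx hy => simp_all [nodeT, add_mul, mul_add]
  | tmul b w =>
  induction r with
  | zero => simp [nodeT]
  | add x y hx hy => simp_all [nodeT, add_mul, mul_add]
  | tmul c r =>
  induction l' with
  | zero => simp [nodeT]
  | add x y hx hy => simp_all [nodeT, add_mul, mul_add]
  | tmul d l' =>
  induction w' with
  | zero => simp [nodeT]
  | add x y hx hy => simp_all [nodeT, add_mul, mul_add]
  | tmul e w' =>
  induction r' with
  | zero => simp [nodeT]
  | add x y hx hy => simp_all [nodeT, mul_add]
  | tmul f r' =>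
  rw [Algebra.TensorProduct.tmul_mul_tmul, letterT_tmul, Algebra.TensorProduct.tmul_mul_tmul,
    Algebra.TensorProduct.tmul_mul_tmul, nodeT_tmul, nodeT_tmul, nodeT_tmul, TriData.tensor_bullet,
    TriData.tensorOp_tmul, aug_nodeL, bullet_nodeL, zero_smul, TensorProduct.tmul_zero,
    add_zero, ← mul_def, ← mul_def]
  simp only [mul_assoc]

/-! ### The coproduct -/

/-- The coproduct of a basis vector. -/
noncomputable def comulTree (K : Type*) [Field K] : PTree → GroveAlgebra K ⊗[K] GroveAlgebra K
  | leaf => 1 ⊗ₜ 1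
  | node l mid r => X K (node l mid r) ⊗ₜ 1 +
      nodeT (comulTree K l) (mid.map fun t => letterT (comulTree K t)).prod (comulTree K r)

/-- The coproduct of the grove algebra. -/
noncomputable def comul (K : Type*) [Field K] :
    GroveAlgebra K →ₗ[K] GroveAlgebra K ⊗[K] GroveAlgebra K :=
  Finsupp.linearCombination K (comulTree K)

theorem comul_X (t : PTree) : comul K (X K t) = comulTree K t := by simp [comul, X]

theorem comul_one : comul K 1 = 1 := by
  change comul K (X K leaf) = _
  rw [comul_X, comulTree]
  rfl

/-- The coaction on words, a morphism of algebras that extends the coproduct on letters. -/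
noncomputable def comulWords (K : Type*) [Field K] : Words K →ₐ[K] GroveAlgebra K ⊗[K] Words K :=
  MonoidAlgebra.lift K _ _ (FreeMonoid.lift fun t => letterT (comul K (X K t)))

theorem comulWords_word (L : List PTree) :
    comulWords K (word K L) = (L.map fun t => letterT (comul K (X K t))).prod := by
  simp [comulWords, word, FreeMonoid.lift_apply]

theorem comulWords_letter (x : GroveAlgebra K) :
    comulWords K (letter K x) = letterT (comul K x) := by
  induction x using induction_X with
  | hadd x y hx hy => simp [hx, hy]
  | hsmul c x hx => simp [hx]
  | hX t => rw [letter_X, comulWords_word, List.map_singleton, List.prod_singleton]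

/-- The trilinear form of the recursion defining Δ, which lets branches be arbitrary elements such
as `r ⋆ z`. -/
theorem comul_nodeL (l : GroveAlgebra K) (w : Words K) (r : GroveAlgebra K) :
    comul K (nodeL l w r) = nodeL l w r ⊗ₜ 1 + nodeT (comul K l) (comulWords K w) (comul K r) := by
  induction l using induction_X with
  | hadd x y hx hy =>
    simp_all [nodeL, nodeT, add_mul, TensorProduct.add_tmul]
    abel
  | hsmul c x hx =>
    simp_all [nodeL, nodeT, TensorProduct.smul_tmul']
    rw [smul_mul_assoc, smul_mul_assoc, map_smul]
  | hX l =>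
  induction w using induction_word with
  | hadd x y hx hy =>
    simp_all [nodeL, nodeT, add_mul, mul_add, TensorProduct.add_tmul]
    abel
  | hsmul c x hx =>
    simp_all [nodeL, nodeT, TensorProduct.smul_tmul']
    rw [mul_smul_comm, smul_mul_assoc, map_smul]
  | hw mid =>
  induction r using induction_X with
  | hadd x y hx hy =>
    simp_all [nodeL, nodeT, mul_add, TensorProduct.add_tmul]
    abel
  | hsmul c x hx =>
    simp_all [nodeL, nodeT, TensorProduct.smul_tmul']
    rw [mul_smul_comm, map_smul]
  | hX r =>
  rw [nodeL_X, comul_X, comulTree, comulWords_word, comul_X, comul_X]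
  simp only [comul_X]

/-! ### Compatibility of the coproduct with the operations -/

theorem lTensor_aug_nodeT {A : Type*} [Ring A] [Algebra K A] (l : A ⊗[K] GroveAlgebra K)
    (w : A ⊗[K] Words K) (r : A ⊗[K] GroveAlgebra K) :
    (triData K).aug.lTensor A (nodeT l w r) = 0 := by
  rw [nodeT, graftT, ← LinearMap.comp_apply, ← LinearMap.lTensor_comp]
  have : (triData K).aug ∘ₗ graftWord K = 0 := LinearMap.ext aug_graftWord
  rw [this, LinearMap.lTensor_zero, LinearMap.zero_apply]

theorem lTensor_aug_comul (x : GroveAlgebra K) :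
    (triData K).aug.lTensor _ (comul K x) = x ⊗ₜ 1 := by
  induction x using induction_X with
  | hadd x y hx hy => simp [hx, hy, TensorProduct.add_tmul]
  | hsmul c x hx => simp [hx, TensorProduct.smul_tmul']
  | hX t =>
  cases t with
  | leaf => simp [comul_X, comulTree, one_def, unitLaws.aug_one]; rfl
  | node l mid r =>
    rw [← nodeL_X, comul_nodeL, map_add, lTensor_aug_nodeT, add_zero, LinearMap.lTensor_tmul,
      one_def, unitLaws.aug_one]

/-- Since `1 ∘ b = 0`, only the correction term survives. Applied to `y = Δ z`, the right counit law
turns it into `(x ∘ z) ⊗ 1`. -/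
theorem tensorOp_tmul_one (op : GroveAlgebra K →ₗ[K] GroveAlgebra K →ₗ[K] GroveAlgebra K)
    (hop : ∀ x, op 1 x = 0) (x : GroveAlgebra K) (y : GroveAlgebra K ⊗[K] GroveAlgebra K) :
    (triData K).tensorOp op (x ⊗ₜ 1) y =
      (op x).rTensor _ ((LinearMap.toSpanSingleton K _ 1 ∘ₗ (triData K).aug).lTensor _ y) := by
  induction y with
  | zero => simp
  | add y z hy hz => simp only [map_add, hy, hz]
  | tmul a b =>
    rw [TriData.tensorOp_tmul, hop, one_def, unitLaws.aug_one]
    simp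

theorem tensorOp_tmul_one_right (op : GroveAlgebra K →ₗ[K] GroveAlgebra K →ₗ[K] GroveAlgebra K)
    (hop : ∀ x, op x 1 = 0) (x : GroveAlgebra K) (y : GroveAlgebra K ⊗[K] GroveAlgebra K) :
    (triData K).tensorOp op y (x ⊗ₜ 1) =
      (op.flip x).rTensor _ ((LinearMap.toSpanSingleton K _ 1 ∘ₗ (triData K).aug).lTensor _ y) := by
  induction y with
  | zero => simp
  | add y z hy hz => simp only [map_add, hy, hz, LinearMap.add_apply]
  | tmul a b =>
    rw [TriData.tensorOp_tmul, hop, one_def, unitLaws.aug_one]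
    simp

theorem lTensor_unit_aug_comul (x : GroveAlgebra K) :
    (LinearMap.toSpanSingleton K (GroveAlgebra K) 1 ∘ₗ (triData K).aug).lTensor _ (comul K x) =
      x ⊗ₜ 1 := by
  rw [LinearMap.lTensor_comp, LinearMap.comp_apply, lTensor_aug_comul]
  simp

theorem lTensor_unit_aug_nodeT (l : GroveAlgebra K ⊗[K] GroveAlgebra K)
    (w : GroveAlgebra K ⊗[K] Words K) (r : GroveAlgebra K ⊗[K] GroveAlgebra K) :
    (LinearMap.toSpanSingleton K (GroveAlgebra K) 1 ∘ₗ (triData K).aug).lTensor _ (nodeT l w r) =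
      0 := by
  rw [LinearMap.lTensor_comp, LinearMap.comp_apply, lTensor_aug_nodeT, map_zero]

/-- The summand `nodeL ⊗ 1` of Δ contributes `(nodeL ≺ z) ⊗ 1` and the summand `nodeT` has its last
branch multiplied by Δz. Multiplicativity is assumed only for `r ⋆ z`, so that the lemma feeds the
induction that proves it in general. -/
theorem comul_prec_nodeL (l : GroveAlgebra K) (w : Words K) (r z : GroveAlgebra K)
    (h : comul K (r * z) = comul K r * comul K z) :
    comul K ((triData K).prec (nodeL l w r) z) =
      (triData K).tensor.prec (comul K (nodeL l w r)) (comul K z) := by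
  rw [comul_nodeL, map_add, LinearMap.add_apply, tensor_prec_nodeT, TriData.tensor_prec,
    tensorOp_tmul_one _ unitLaws.one_prec, lTensor_unit_aug_comul, ← h, LinearMap.rTensor_tmul,
    prec_nodeL, comul_nodeL]
  rfl

theorem comul_succ_nodeL (z l : GroveAlgebra K) (w : Words K) (r : GroveAlgebra K)
    (h : comul K (z * l) = comul K z * comul K l) :
    comul K ((triData K).succ z (nodeL l w r)) =
      (triData K).tensor.succ (comul K z) (comul K (nodeL l w r)) := by
  rw [comul_nodeL, map_add, tensor_succ_nodeT, TriData.tensor_succ,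
    tensorOp_tmul_one_right _ unitLaws.succ_one, lTensor_unit_aug_comul, ← h,
    LinearMap.rTensor_tmul, LinearMap.flip_apply, succ_nodeL, comul_nodeL]
  rfl

theorem comul_bullet_nodeL (l : GroveAlgebra K) (w : Words K) (r l' : GroveAlgebra K)
    (w' : Words K) (r' : GroveAlgebra K) (h : comul K (r * l') = comul K r * comul K l') :
    comul K ((triData K).bullet (nodeL l w r) (nodeL l' w' r')) =
      (triData K).tensor.bullet (comul K (nodeL l w r)) (comul K (nodeL l' w' r')) := by
  have h₁ : (triData K).tensor.bullet (nodeL l w r ⊗ₜ[K] 1) (comul K (nodeL l' w' r')) =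
      (triData K).bullet (nodeL l w r) (nodeL l' w' r') ⊗ₜ 1 := by
    rw [TriData.tensor_bullet, tensorOp_tmul_one _ unitLaws.one_bullet, lTensor_unit_aug_comul,
      LinearMap.rTensor_tmul]
  have h₂ : (triData K).tensor.bullet (nodeT (comul K l) (comulWords K w) (comul K r))
      (nodeL l' w' r' ⊗ₜ[K] 1) = 0 := by
    rw [TriData.tensor_bullet, tensorOp_tmul_one_right _ unitLaws.bullet_one,
      lTensor_unit_aug_nodeT, map_zero]
  rw [comul_nodeL l w r, map_add, LinearMap.add_apply, h₁, comul_nodeL l' w' r', map_add, h₂,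
    zero_add, tensor_bullet_nodeT, ← h, bullet_nodeL, comul_nodeL, map_mul, map_mul,
    comulWords_letter]
  rfl

/-- Induction on total degree: the three operations require multiplicativity on the pairs `(r, z)`,
`(t, l')` and `(r, l')`, all of smaller degree. -/
theorem comul_X_mul_X (t z : PTree) :
    comul K (X K t * X K z) = comul K (X K t) * comul K (X K z) := by
  induction hn : t.deg + z.deg using Nat.strong_induction_on generalizing t z with
  | _ n ih =>
  rcases t with _ | ⟨l, mid, r⟩
  · change comul K (1 * _) = comul K 1 * _
    rw [comul_one, one_mul, one_mul]
  rcases z with _ | ⟨l', mid', r'⟩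
  · change comul K (_ * 1) = _ * comul K 1
    rw [comul_one, mul_one, mul_one]
  simp only [deg_node] at hn
  have h₁ := ih _ (by simp only [deg_node]; omega) r (node l' mid' r') rfl
  have h₂ := ih _ (by simp only [deg_node]; omega) (node l mid r) l' rfl
  have h₃ := ih _ (by omega) r l' rfl
  rw [mul_def, TriData.star_apply, ← tensor_star_eq_mul, TriData.star_apply]
  simp only [← nodeL_X l mid r, ← nodeL_X l' mid' r'] at h₁ h₂ ⊢
  rw [map_add, map_add, map_add, comul_prec_nodeL _ _ _ _ h₁, comul_succ_nodeL _ _ _ _ h₂,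
    comul_bullet_nodeL _ _ _ _ _ _ h₃, map_smul]
  -- Only the unit parts remain. Both vanish, because nodes and their coproducts have augmentation
  -- zero.
  congr 1
  rw [comul_nodeL, map_add, TriData.tensor_aug_tmul, aug_nodeL, aug_nodeL]
  have : (triData K).tensor.aug (nodeT (comul K (X K l)) (comulWords K (word K mid))
      (comul K (X K r))) = 0 := by
    have h (x : GroveAlgebra K ⊗[K] GroveAlgebra K) : (triData K).tensor.aug x =
        LinearMap.mul' K K ((triData K).aug.rTensor _ ((triData K).aug.lTensor _ x)) := by
      rw [← LinearMap.comp_apply (LinearMap.rTensor _ _), LinearMap.rTensor_comp_lTensor]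
      rfl
    rw [h, lTensor_aug_nodeT, map_zero, map_zero]
  rw [this]
  simp

theorem comul_mul (x y : GroveAlgebra K) : comul K (x * y) = comul K x * comul K y := by
  induction x using induction_X with
  | hadd x y hx hy => simp [hx, hy, add_mul]
  | hsmul c x hx => rw [smul_mul_assoc, map_smul, map_smul, hx, smul_mul_assoc]
  | hX t =>
  induction y using induction_X with
  | hadd x y hx hy => simp [hx, hy, mul_add]
  | hsmul c x hx => rw [mul_smul_comm, map_smul, map_smul, hx, mul_smul_comm]
  | hX z => exact comul_X_mul_X t z

theorem comul_prec (x y : GroveAlgebra K) : comul K ((triData K).prec x y) =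
    (triData K).tensor.prec (comul K x) (comul K y) := by
  induction x using induction_X with
  | hadd x y hx hy => simp [hx, hy]
  | hsmul c x hx => simp [hx]
  | hX t =>
  cases t with
  | leaf =>
    change comul K ((triData K).prec (triData K).one _) = (triData K).tensor.prec (comul K 1) _
    rw [unitLaws.one_prec, map_zero, comul_one]
    exact (unitLaws.tensor.one_prec _).symm
  | node l mid r => rw [← nodeL_X, comul_prec_nodeL _ _ _ _ (comul_mul _ _)]

theorem comul_succ (x y : GroveAlgebra K) : comul K ((triData K).succ x y) =
    (triData K).tensor.succ (comul K x) (comul K y) := by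
  induction y using induction_X with
  | hadd x y hx hy => simp [hx, hy]
  | hsmul c x hx => simp [hx]
  | hX t =>
  cases t with
  | leaf =>
    change comul K ((triData K).succ _ (triData K).one) = (triData K).tensor.succ _ (comul K 1)
    rw [unitLaws.succ_one, map_zero, comul_one]
    exact (unitLaws.tensor.succ_one _).symm
  | node l mid r => rw [← nodeL_X, comul_succ_nodeL _ _ _ _ (comul_mul _ _)]

theorem comul_bullet (x y : GroveAlgebra K) : comul K ((triData K).bullet x y) =
    (triData K).tensor.bullet (comul K x) (comul K y) := by
  induction x using induction_X with
  | hadd x y hx hy => simp [hx, hy]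
  | hsmul c x hx => simp [hx]
  | hX t =>
  induction y using induction_X with
  | hadd x y hx hy => simp [hx, hy]
  | hsmul c x hx => simp [hx]
  | hX z =>
  cases t with
  | leaf =>
    change comul K ((triData K).bullet (triData K).one _) = (triData K).tensor.bullet (comul K 1) _
    rw [unitLaws.one_bullet, map_zero, comul_one]
    exact (unitLaws.tensor.one_bullet _).symm
  | node l mid r =>
  cases z with
  | leaf =>
    change comul K ((triData K).bullet _ (triData K).one) =
      (triData K).tensor.bullet _ (comul K 1)
    rw [unitLaws.bullet_one, map_zero, comul_one]
    exact (unitLaws.tensor.bullet_one _).symm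
  | node l' mid' r' =>
    rw [← nodeL_X, ← nodeL_X, comul_bullet_nodeL _ _ _ _ _ _ (comul_mul _ _)]

end GroveAlgebra

namespace GroveAlgebra

variable {K : Type*} [Field K]

open PTree

/-! ### Coassociativity and counit -/

/-- Grafting is natural in the algebra of coefficients. The applications are `φ = Δ` and `φ = ε`,
which is where their multiplicativity enters. -/
theorem rTensor_nodeT {A B : Type*} [Ring A] [Algebra K A] [Ring B] [Algebra K B] (φ : A →ₐ[K] B)
    (l : A ⊗[K] GroveAlgebra K) (w : A ⊗[K] Words K) (r : A ⊗[K] GroveAlgebra K) :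
    φ.toLinearMap.rTensor _ (nodeT l w r) = nodeT (φ.toLinearMap.rTensor _ l)
      (Algebra.TensorProduct.map φ (AlgHom.id K (Words K)) w) (φ.toLinearMap.rTensor _ r) := by
  induction l with
  | zero => simp [nodeT]
  | add x y hx hy => simp_all [nodeT, add_mul]
  | tmul a l =>
  induction w with
  | zero => simp [nodeT]
  | add x y hx hy => simp_all [nodeT, add_mul, mul_add]
  | tmul b w =>
  induction r with
  | zero => simp [nodeT]
  | add x y hx hy => simp_all [nodeT, mul_add]
  | tmul c r => simp [nodeT_tmul]

theorem map_letterT {A B : Type*} [Ring A] [Algebra K A] [Ring B] [Algebra K B] (φ : A →ₐ[K] B)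
    (x : A ⊗[K] GroveAlgebra K) : Algebra.TensorProduct.map φ (AlgHom.id K (Words K)) (letterT x) =
      letterT (φ.toLinearMap.rTensor _ x) := by
  induction x with
  | zero => simp
  | add x y hx hy => simp [hx, hy]
  | tmul a l => simp

/-- The coproduct as a morphism of algebras. -/
noncomputable def comulHom (K : Type*) [Field K] :
    GroveAlgebra K →ₐ[K] GroveAlgebra K ⊗[K] GroveAlgebra K :=
  AlgHom.ofLinearMap (comul K) comul_one comul_mul

theorem comulHom_toLinearMap : (comulHom K).toLinearMap = comul K := rfl

/-- The augmentation as a morphism of algebras. -/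
noncomputable def augHom (K : Type*) [Field K] : GroveAlgebra K →ₐ[K] K :=
  AlgHom.ofLinearMap (triData K).aug aug_X_leaf unitLaws.aug_star

theorem augHom_toLinearMap : (augHom K).toLinearMap = (triData K).aug := rfl

section Bracketing

variable {A B : Type*} [Ring A] [Algebra K A] [Ring B] [Algebra K B]

/-- Rebracketing merges the two coefficient factors into the single algebra `A ⊗ B`, so that `id ⊗
Δ` can again be expressed through `nodeT`. -/
theorem assoc_symm_nodeT (a b c : A) (l : B ⊗[K] GroveAlgebra K) (w : B ⊗[K] Words K)
    (r : B ⊗[K] GroveAlgebra K) :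
    (TensorProduct.assoc K _ _ _).symm ((a * b * c) ⊗ₜ[K] nodeT l w r) =
      nodeT ((TensorProduct.assoc K _ _ _).symm (a ⊗ₜ[K] l))
        ((TensorProduct.assoc K _ _ _).symm (b ⊗ₜ[K] w))
        ((TensorProduct.assoc K _ _ _).symm (c ⊗ₜ[K] r)) := by
  induction l with
  | zero => simp [nodeT]
  | add x y hx hy => simp_all [nodeT, add_mul, TensorProduct.tmul_add]
  | tmul a' l =>
  induction w with
  | zero => simp [nodeT]
  | add x y hx hy => simp_all [nodeT, add_mul, mul_add, TensorProduct.tmul_add]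
  | tmul b' w =>
  induction r with
  | zero => simp [nodeT]
  | add x y hx hy => simp_all [nodeT, mul_add, TensorProduct.tmul_add]
  | tmul c' r => simp [nodeT_tmul]

theorem assoc_symm_letterT (a : A) (x : B ⊗[K] GroveAlgebra K) :
    (TensorProduct.assoc K _ _ _).symm (a ⊗ₜ[K] letterT x) =
      letterT ((TensorProduct.assoc K _ _ _).symm (a ⊗ₜ[K] x)) := by
  induction x with
  | zero => simp
  | add x y hx hy => simp [hx, hy, TensorProduct.tmul_add]
  | tmul b c => simp

/-- The map `id ⊗ δ`, with values bracketed to the left. -/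
noncomputable def lcoact (A : Type*) [Ring A] [Algebra K A]
    (δ : GroveAlgebra K →ₗ[K] B ⊗[K] GroveAlgebra K) :
    A ⊗[K] GroveAlgebra K →ₗ[K] (A ⊗[K] B) ⊗[K] GroveAlgebra K :=
  (TensorProduct.assoc K _ _ _).symm.toLinearMap ∘ₗ δ.lTensor _

/-- The map `id ⊗ δ` on words, with values bracketed to the left. -/
noncomputable def lcoactWords (A : Type*) [Ring A] [Algebra K A]
    (δ : Words K →ₐ[K] B ⊗[K] Words K) : A ⊗[K] Words K →ₐ[K] (A ⊗[K] B) ⊗[K] Words K :=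
  (Algebra.TensorProduct.assoc K K K _ _ _).symm.toAlgHom.comp
    (Algebra.TensorProduct.map (AlgHom.id K _) δ)

theorem lcoact_tmul (δ : GroveAlgebra K →ₗ[K] B ⊗[K] GroveAlgebra K) (a : A)
    (x : GroveAlgebra K) :
    lcoact A δ (a ⊗ₜ x) = (TensorProduct.assoc K _ _ _).symm (a ⊗ₜ δ x) := rfl

theorem lcoactWords_tmul (δ : Words K →ₐ[K] B ⊗[K] Words K) (a : A) (w : Words K) :
    lcoactWords A δ (a ⊗ₜ w) = (TensorProduct.assoc K _ _ _).symm (a ⊗ₜ δ w) := rfl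

theorem lcoactWords_letterT {δ : GroveAlgebra K →ₗ[K] B ⊗[K] GroveAlgebra K}
    {δ' : Words K →ₐ[K] B ⊗[K] Words K} (h : ∀ x, δ' (letter K x) = letterT (δ x))
    (x : A ⊗[K] GroveAlgebra K) : lcoactWords A δ' (letterT x) = letterT (lcoact A δ x) := by
  induction x with
  | zero => simp
  | add x y hx hy => simp [hx, hy]
  | tmul a b => rw [letterT_tmul, lcoactWords_tmul, h, assoc_symm_letterT, lcoact_tmul]

theorem lcoact_nodeT {δ : GroveAlgebra K →ₗ[K] B ⊗[K] GroveAlgebra K}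
    {δ' : Words K →ₐ[K] B ⊗[K] Words K} {u : GroveAlgebra K →ₗ[K] B}
    (h : ∀ l w r, δ (nodeL l w r) = u (nodeL l w r) ⊗ₜ 1 + nodeT (δ l) (δ' w) (δ r))
    (l : A ⊗[K] GroveAlgebra K) (w : A ⊗[K] Words K) (r : A ⊗[K] GroveAlgebra K) :
    lcoact A δ (nodeT l w r) = u.lTensor A (nodeT l w r) ⊗ₜ 1 +
      nodeT (lcoact A δ l) (lcoactWords A δ' w) (lcoact A δ r) := by
  induction l with
  | zero => simp [nodeT]
  | add x y hx hy =>
    simp_all [nodeT, add_mul, TensorProduct.add_tmul]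
    abel
  | tmul a l =>
  induction w with
  | zero => simp [nodeT]
  | add x y hx hy =>
    simp_all [nodeT, add_mul, mul_add, TensorProduct.add_tmul]
    abel
  | tmul b w =>
  induction r with
  | zero => simp [nodeT]
  | add x y hx hy =>
    simp_all [nodeT, mul_add, TensorProduct.add_tmul]
    abel
  | tmul c r =>
    rw [nodeT_tmul, lcoact_tmul, h, TensorProduct.tmul_add, map_add, assoc_symm_nodeT]
    rfl

theorem map_list_prod_congr (f g : A →ₐ[K] B) {ι : Type*} (v : ι → A) (L : List ι)
    (h : ∀ s ∈ L, f (v s) = g (v s)) : f (L.map v).prod = g (L.map v).prod := by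
  rw [map_list_prod, map_list_prod, List.map_map, List.map_map]
  congr 1
  exact List.map_congr_left h

end Bracketing

theorem lcoact_comul_nodeT (l : GroveAlgebra K ⊗[K] GroveAlgebra K)
    (w : GroveAlgebra K ⊗[K] Words K) (r : GroveAlgebra K ⊗[K] GroveAlgebra K) :
    lcoact _ (comul K) (nodeT l w r) = nodeT l w r ⊗ₜ 1 +
      nodeT (lcoact _ (comul K) l) (lcoactWords _ (comulWords K) w) (lcoact _ (comul K) r) := by
  have hc (l : GroveAlgebra K) (w : Words K) (r : GroveAlgebra K) : comul K (nodeL l w r) =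
      (LinearMap.id : GroveAlgebra K →ₗ[K] GroveAlgebra K) (nodeL l w r) ⊗ₜ 1 +
        nodeT (comul K l) (comulWords K w) (comul K r) := by
    rw [LinearMap.id_apply, comul_nodeL]
  have h := lcoact_nodeT (A := GroveAlgebra K) (δ := comul K) (δ' := comulWords K)
    (u := LinearMap.id) hc l w r
  rw [LinearMap.lTensor_id, LinearMap.id_apply] at h
  exact h

/-- For a node both sides equal `t ⊗ 1 ⊗ 1 + nodeT ⊗ 1` plus a grafting of the iterated coproducts
of the branches, which agree by induction on the tree. -/
theorem rTensor_comul_comul_X (t : PTree) :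
    (comul K).rTensor _ (comul K (X K t)) = lcoact _ (comul K) (comul K (X K t)) := by
  induction t using PTree.induction_on with
  | leaf =>
    change (comul K).rTensor _ (comul K 1) = lcoact _ (comul K) (comul K 1)
    rw [comul_one, Algebra.TensorProduct.one_def, LinearMap.rTensor_tmul, lcoact_tmul, comul_one]
    rfl
  | node l mid r hl hmid hr =>
    -- Both iterated coactions on words are algebra morphisms, so agreement on the letters of `mid`
    -- suffices.
    have h : Algebra.TensorProduct.map (comulHom K) (AlgHom.id K (Words K))
        (comulWords K (word K mid)) = lcoactWords _ (comulWords K) (comulWords K (word K mid)) := by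
      rw [comulWords_word]
      refine map_list_prod_congr (Algebra.TensorProduct.map (comulHom K) (AlgHom.id K (Words K)))
        (lcoactWords (GroveAlgebra K) (comulWords K)) _ _ fun s hs => ?_
      exact (map_letterT _ _).trans
        ((congrArg letterT (hmid s hs)).trans (lcoactWords_letterT comulWords_letter _).symm)
    have h₁ := rTensor_nodeT (comulHom K) (comul K (X K l)) (comulWords K (word K mid))
      (comul K (X K r))
    have h₂ := lcoact_comul_nodeT (comul K (X K l)) (comulWords K (word K mid)) (comul K (X K r))
    rw [h, comulHom_toLinearMap, hl, hr] at h₁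
    rw [← nodeL_X, comul_nodeL, LinearMap.map_add, LinearMap.map_add, LinearMap.rTensor_tmul,
      comul_nodeL, h₁, h₂, lcoact_tmul, comul_one, TensorProduct.add_tmul, add_assoc]
    rfl

theorem comul_coassoc : (TensorProduct.assoc K _ _ _).toLinearMap ∘ₗ (comul K).rTensor _ ∘ₗ
    comul K = (comul K).lTensor _ ∘ₗ comul K := by
  refine LinearMap.ext fun x => ?_
  induction x using induction_X with
  | hadd x y hx hy => rw [LinearMap.map_add, hx, hy, LinearMap.map_add]
  | hsmul c x hx => rw [LinearMap.map_smul, hx, LinearMap.map_smul]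
  | hX t =>
    rw [LinearMap.comp_apply, LinearMap.comp_apply, rTensor_comul_comul_X]
    exact LinearEquiv.apply_symm_apply _ _

theorem nodeT_one_tmul {A : Type*} [Ring A] [Algebra K A] (l : GroveAlgebra K) (w : Words K)
    (r : GroveAlgebra K) :
    nodeT ((1 : A) ⊗ₜ[K] l) (1 ⊗ₜ w) (1 ⊗ₜ r) = 1 ⊗ₜ nodeL l w r := by
  rw [nodeT_tmul, mul_one, mul_one]

/-- Applying ε to the coefficients kills `t ⊗ 1` for a node and, by induction, replaces every branch
`s` in the grafted summand by `1 ⊗ s`, so the grafting reassembles `t`. -/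
theorem rTensor_aug_comul_X (t : PTree) :
    (triData K).aug.rTensor _ (comul K (X K t)) = 1 ⊗ₜ X K t := by
  induction t using PTree.induction_on with
  | leaf =>
    change (triData K).aug.rTensor _ (comul K 1) = _
    rw [comul_one, Algebra.TensorProduct.one_def, LinearMap.rTensor_tmul, one_def,
      unitLaws.aug_one]
    rfl
  | node l mid r hl hmid hr =>
    have h : Algebra.TensorProduct.map (augHom K) (AlgHom.id K (Words K))
        (comulWords K (word K mid)) =
          (Algebra.TensorProduct.includeRight : Words K →ₐ[K] K ⊗[K] Words K) (word K mid) := by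
      rw [comulWords_word]
      induction mid with
      | nil => rw [List.map_nil, List.prod_nil, map_one, word_nil, map_one]
      | cons s mid ih =>
        rw [List.map_cons, List.prod_cons, map_mul, ih fun u hu => hmid u (List.mem_cons_of_mem _ hu),
          map_letterT, augHom_toLinearMap, hmid s List.mem_cons_self, letterT_tmul, letter_X,
          word_cons s mid, map_mul]
        rfl
    rw [← nodeL_X, comul_nodeL, map_add, LinearMap.rTensor_tmul, aug_nodeL,
      ← augHom_toLinearMap, rTensor_nodeT, h, augHom_toLinearMap, hl, hr,
      Algebra.TensorProduct.includeRight_apply, nodeT_one_tmul, TensorProduct.zero_tmul, zero_add]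

theorem rTensor_aug_comul (x : GroveAlgebra K) :
    (triData K).aug.rTensor _ (comul K x) = 1 ⊗ₜ x := by
  induction x using induction_X with
  | hadd x y hx hy => rw [map_add, map_add, hx, hy, TensorProduct.tmul_add]
  | hsmul c x hx => rw [map_smul, map_smul, hx, TensorProduct.tmul_smul]
  | hX t => exact rTensor_aug_comul_X t

/-! ### The degree filtration -/

/-- The span of the basis vectors of degree at most `n`. -/
noncomputable def degLE (K : Type*) [Field K] (n : ℕ) : Submodule K (GroveAlgebra K) :=
  Submodule.span K {x | ∃ t, t.deg ≤ n ∧ X K t = x}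

/-- The span of the tensors `Xᵗ ⊗ Xᶻ` of total degree at most `n`. -/
noncomputable def tensorDegLE (K : Type*) [Field K] (n : ℕ) :
    Submodule K (GroveAlgebra K ⊗[K] GroveAlgebra K) :=
  Submodule.span K {x | ∃ t z, t.deg + z.deg ≤ n ∧ X K t ⊗ₜ X K z = x}

/-- The span of the tensors of trees and words of total degree at most `n`, where the degree of
each letter of the word is increased by one. -/
noncomputable def wordDegLE (K : Type*) [Field K] (n : ℕ) :
    Submodule K (GroveAlgebra K ⊗[K] Words K) :=
  Submodule.span K
    {x | ∃ t L, t.deg + ((L.map deg).sum + L.length) ≤ n ∧ X K t ⊗ₜ word K L = x}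

theorem letterT_mem {x : GroveAlgebra K ⊗[K] GroveAlgebra K} {n : ℕ} (hx : x ∈ tensorDegLE K n) :
    letterT x ∈ wordDegLE K (n + 1) := by
  induction hx using Submodule.span_induction with
  | mem x hx =>
    obtain ⟨t, z, h, rfl⟩ := hx
    rw [letterT_tmul, letter_X]
    refine Submodule.subset_span ⟨t, [z], ?_, rfl⟩
    simp only [List.map_singleton, List.sum_singleton, List.length_singleton]
    omega
  | zero => rw [map_zero]; exact zero_mem _
  | add x y _ _ hx hy => rw [map_add]; exact add_mem hx hy
  | smul c x _ hx => rw [map_smul]; exact Submodule.smul_mem _ _ hx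

theorem mul_mem_wordDegLE {x y : GroveAlgebra K ⊗[K] Words K} {m n : ℕ} (hx : x ∈ wordDegLE K m)
    (hy : y ∈ wordDegLE K n) : x * y ∈ wordDegLE K (m + n) := by
  induction hx using Submodule.span_induction with
  | mem x hx =>
    obtain ⟨t, L, h, rfl⟩ := hx
    induction hy using Submodule.span_induction with
    | mem y hy =>
      obtain ⟨z, L', h', rfl⟩ := hy
      rw [Algebra.TensorProduct.tmul_mul_tmul, ← word_append, mul_def, star_X_X, XGrove,
        TensorProduct.sum_tmul]
      refine sum_mem fun u hu => Submodule.subset_span ⟨u, L ++ L', ?_, rfl⟩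
      rw [deg_of_mem_add hu, List.map_append, List.sum_append, List.length_append]
      omega
    | zero => rw [mul_zero]; exact zero_mem _
    | add x y _ _ hx hy => rw [mul_add]; exact add_mem hx hy
    | smul c x _ hx => rw [mul_smul_comm]; exact Submodule.smul_mem _ _ hx
  | zero => rw [zero_mul]; exact zero_mem _
  | add x y _ _ hx hy => rw [add_mul]; exact add_mem hx hy
  | smul c x _ hx => rw [smul_mul_assoc]; exact Submodule.smul_mem _ _ hx

/-- A node with `k` branches has the degree of its branches plus `k - 1`, whereas each of the `k`
letters has weight one; hence the drop by one. Shorter words graft to zero. -/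
theorem graftT_mem {x : GroveAlgebra K ⊗[K] Words K} {n : ℕ} (hx : x ∈ wordDegLE K (n + 1)) :
    graftT x ∈ tensorDegLE K n := by
  induction hx using Submodule.span_induction with
  | mem x hx =>
    obtain ⟨t, L, h, rfl⟩ := hx
    rw [graftT_tmul, graftWord_word]
    rcases L with _ | ⟨l, L⟩
    · simp [graftList]
    rcases List.eq_nil_or_concat L with rfl | ⟨mid, r, rfl⟩
    · simp [graftList]
    rw [List.concat_eq_append] at h ⊢
    rw [graftList_cons_append]
    refine Submodule.subset_span ⟨t, _, ?_, rfl⟩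
    simp only [deg_node, List.map_cons, List.map_append, List.sum_cons, List.sum_append,
      List.length_cons, List.length_append, List.map_nil, List.sum_nil, List.length_nil] at h ⊢
    omega
  | zero => rw [map_zero]; exact zero_mem _
  | add x y _ _ hx hy => rw [map_add]; exact add_mem hx hy
  | smul c x _ hx => rw [map_smul]; exact Submodule.smul_mem _ _ hx

theorem comul_X_mem (t : PTree) : comul K (X K t) ∈ tensorDegLE K t.deg := by
  induction t using PTree.induction_on with
  | leaf =>
    change comul K 1 ∈ _
    rw [comul_one]
    exact Submodule.subset_span ⟨leaf, leaf, by simp, rfl⟩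
  | node l mid r hl hmid hr =>
    rw [← nodeL_X, comul_nodeL]
    refine add_mem ?_ ?_
    · rw [nodeL_X]
      exact Submodule.subset_span ⟨_, leaf, by simp, rfl⟩
    · have h : comulWords K (word K mid) ∈ wordDegLE K ((mid.map deg).sum + mid.length) := by
        rw [comulWords_word]
        induction mid with
        | nil => exact Submodule.subset_span ⟨leaf, [], by simp, rfl⟩
        | cons s mid ih =>
          have := mul_mem_wordDegLE (letterT_mem (hmid s List.mem_cons_self))
            (ih fun u hu => hmid u (List.mem_cons_of_mem _ hu))
          rw [List.map_cons, List.map_cons, List.prod_cons, List.sum_cons, List.length_cons]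
          convert this using 1
          congr 1
          omega
      refine graftT_mem ?_
      have := mul_mem_wordDegLE (mul_mem_wordDegLE (letterT_mem hl) h) (letterT_mem hr)
      rw [deg_node]
      convert this using 1
      congr 1
      omega

theorem degLE_mono : Monotone (degLE K) := fun _ _ h =>
  Submodule.span_mono fun _ ⟨t, ht, hx⟩ => ⟨t, ht.trans h, hx⟩

theorem exists_mem_degLE (x : GroveAlgebra K) : ∃ n, x ∈ degLE K n := by
  induction x using induction_X with
  | hadd x y hx hy =>
    obtain ⟨m, hm⟩ := hx
    obtain ⟨n, hn⟩ := hy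
    exact ⟨max m n, add_mem (degLE_mono (le_max_left m n) hm) (degLE_mono (le_max_right m n) hn)⟩
  | hsmul c x hx =>
    obtain ⟨n, hn⟩ := hx
    exact ⟨n, Submodule.smul_mem _ _ hn⟩
  | hX t => exact ⟨t.deg, Submodule.subset_span ⟨t, le_rfl, rfl⟩⟩

/-! ### Connectedness -/

/-- The map `x ↦ ε(x) 1`. -/
noncomputable def unitAug (K : Type*) [Field K] : GroveAlgebra K →ₗ[K] GroveAlgebra K :=
  (triData K).aug.smulRight (triData K).one

/-- The projection onto the augmentation ideal. -/
noncomputable def projAug (K : Type*) [Field K] : GroveAlgebra K →ₗ[K] GroveAlgebra K :=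
  LinearMap.id - unitAug K

theorem projAug_X_leaf : projAug K (X K leaf) = 0 := by
  simp [projAug, unitAug, aug_X_leaf, one_eq]

theorem projAug_X_node (l : PTree) (mid : List PTree) (r : PTree) :
    projAug K (X K (node l mid r)) = X K (node l mid r) := by
  simp [projAug, unitAug, aug_X_node]

theorem lTensor_unitAug_comul (x : GroveAlgebra K) :
    (unitAug K).lTensor _ (comul K x) = x ⊗ₜ (triData K).one := by
  have h : unitAug K = LinearMap.toSpanSingleton K _ (triData K).one ∘ₗ (triData K).aug := by
    ext1 x; rfl
  rw [h, LinearMap.lTensor_comp, LinearMap.comp_apply, lTensor_aug_comul]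
  simp

theorem rTensor_unitAug_comul (x : GroveAlgebra K) :
    (unitAug K).rTensor _ (comul K x) = (triData K).one ⊗ₜ x := by
  have h : unitAug K = LinearMap.toSpanSingleton K _ (triData K).one ∘ₗ (triData K).aug := by
    ext1 x; rfl
  rw [h, LinearMap.rTensor_comp, LinearMap.comp_apply, rTensor_aug_comul]
  simp

/-- Expand `(id - ε1) ⊗ (id - ε1)` and use both counit laws: up to a multiple of `1 ⊗ 1`, the
reduced coproduct is the projection of Δ onto the square of the augmentation ideal. -/
theorem map_projAug_comul (x : GroveAlgebra K) :
    TensorProduct.map (projAug K) (projAug K) (comul K x) =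
      comul K x - x ⊗ₜ (triData K).one - (triData K).one ⊗ₜ x +
        (triData K).aug x • ((triData K).one ⊗ₜ (triData K).one) := by
  rw [← LinearMap.lTensor_comp_rTensor, LinearMap.comp_apply, projAug, LinearMap.rTensor_sub,
    LinearMap.sub_apply, rTensor_unitAug_comul, LinearMap.rTensor_id, LinearMap.id_apply,
    LinearMap.lTensor_sub, LinearMap.lTensor_id, LinearMap.sub_apply, map_sub, map_sub,
    lTensor_unitAug_comul]
  simp [unitAug]
  abel

/-- After projection both tensor factors are nodes, hence of degree at least one; as their degrees
sum to at most `n + 1`, each is at most `n`. -/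
theorem degLE_le_primFiltration (n : ℕ) : degLE K n ≤ (triData K).primFiltration (comul K) n := by
  induction n with
  | zero =>
    refine Submodule.span_mono ?_
    rintro _ ⟨t, ht, rfl⟩
    rw [deg_eq_zero_iff.1 (Nat.le_zero.1 ht)]
    rfl
  | succ n ih =>
    have hr {a b : GroveAlgebra K} (ha : a ∈ degLE K n) (hb : b ∈ degLE K n) : a ⊗ₜ[K] b ∈
        LinearMap.range (TensorProduct.map ((triData K).primFiltration (comul K) n).subtype
          ((triData K).primFiltration (comul K) n).subtype) :=
      ⟨⟨a, ih ha⟩ ⊗ₜ ⟨b, ih hb⟩, rfl⟩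
    have hone : (triData K).one ∈ degLE K n := Submodule.subset_span ⟨leaf, by simp, rfl⟩
    have hp {x : GroveAlgebra K ⊗[K] GroveAlgebra K} (hx : x ∈ tensorDegLE K (n + 1)) :
        TensorProduct.map (projAug K) (projAug K) x ∈
        LinearMap.range (TensorProduct.map ((triData K).primFiltration (comul K) n).subtype
          ((triData K).primFiltration (comul K) n).subtype) := by
      induction hx using Submodule.span_induction with
      | mem x hx =>
        obtain ⟨t, z, h, rfl⟩ := hx
        rw [TensorProduct.map_tmul]
        cases t with
        | leaf => rw [projAug_X_leaf, TensorProduct.zero_tmul]; exact zero_mem _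
        | node l mid r =>
        cases z with
        | leaf => rw [projAug_X_leaf, TensorProduct.tmul_zero]; exact zero_mem _
        | node l' mid' r' =>
        rw [projAug_X_node, projAug_X_node]
        have h₁ := deg_node l mid r
        have h₂ := deg_node l' mid' r'
        exact hr (Submodule.subset_span ⟨_, by omega, rfl⟩)
          (Submodule.subset_span ⟨_, by omega, rfl⟩)
      | zero => rw [map_zero]; exact zero_mem _
      | add x y _ _ hx hy => rw [map_add]; exact add_mem hx hy
      | smul c x _ hx => rw [map_smul]; exact Submodule.smul_mem _ _ hx
    refine Submodule.span_le.2 ?_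
    rintro _ ⟨t, ht, rfl⟩
    have hmono : tensorDegLE K t.deg ≤ tensorDegLE K (n + 1) :=
      Submodule.span_mono fun _ ⟨u, z, h, hx⟩ => ⟨u, z, h.trans ht, hx⟩
    -- The reduced coproduct differs from the projected one by `ε(x) 1 ⊗ 1`, which also lies in `Fₙ
    -- ⊗ Fₙ`.
    have h := sub_mem (hp (hmono (comul_X_mem t)))
      (Submodule.smul_mem _ ((triData K).aug (X K t)) (hr hone hone))
    rw [map_projAug_comul, add_sub_cancel_right, sub_right_comm] at h
    exact h

theorem comul_connected (x : GroveAlgebra K) :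
    ∃ r, x ∈ (triData K).primFiltration (comul K) r := by
  obtain ⟨n, hn⟩ := exists_mem_degLE x
  exact ⟨n, degLE_le_primFiltration n hn⟩

/-! ### The antipode -/

/-- The convolution product of linear endomorphisms. -/
noncomputable def conv (f g : GroveAlgebra K →ₗ[K] GroveAlgebra K) :
    GroveAlgebra K →ₗ[K] GroveAlgebra K :=
  TensorProduct.lift (triData K).star ∘ₗ TensorProduct.map f g ∘ₗ comul K

theorem conv_add_left (f f' g : GroveAlgebra K →ₗ[K] GroveAlgebra K) :
    conv (f + f') g = conv f g + conv f' g := by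
  rw [conv, TensorProduct.map_add_left, LinearMap.add_comp, LinearMap.comp_add, conv, conv]

theorem conv_add_right (f g g' : GroveAlgebra K →ₗ[K] GroveAlgebra K) :
    conv f (g + g') = conv f g + conv f g' := by
  rw [conv, TensorProduct.map_add_right, LinearMap.add_comp, LinearMap.comp_add, conv, conv]

theorem conv_smul_left (c : K) (f g : GroveAlgebra K →ₗ[K] GroveAlgebra K) :
    conv (c • f) g = c • conv f g := by
  rw [conv, TensorProduct.map_smul_left, LinearMap.smul_comp, LinearMap.comp_smul, conv]

theorem conv_smul_right (c : K) (f g : GroveAlgebra K →ₗ[K] GroveAlgebra K) :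
    conv f (c • g) = c • conv f g := by
  rw [conv, TensorProduct.map_smul_right, LinearMap.smul_comp, LinearMap.comp_smul, conv]

theorem conv_unitAug_right (f : GroveAlgebra K →ₗ[K] GroveAlgebra K) : conv f (unitAug K) = f := by
  refine LinearMap.ext fun x => ?_
  rw [conv, LinearMap.comp_apply, LinearMap.comp_apply, ← LinearMap.rTensor_comp_lTensor,
    LinearMap.comp_apply, lTensor_unitAug_comul, LinearMap.rTensor_tmul, TensorProduct.lift.tmul,
    unitLaws.star_one]

theorem conv_unitAug_left (f : GroveAlgebra K →ₗ[K] GroveAlgebra K) : conv (unitAug K) f = f := by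
  refine LinearMap.ext fun x => ?_
  rw [conv, LinearMap.comp_apply, LinearMap.comp_apply, ← LinearMap.lTensor_comp_rTensor,
    LinearMap.comp_apply, rTensor_unitAug_comul, LinearMap.lTensor_tmul, TensorProduct.lift.tmul,
    unitLaws.one_star]

theorem lift_map_assoc {A : Type*} [AddCommGroup A] [Module K A] {m : A →ₗ[K] A →ₗ[K] A}
    (hm : ∀ x y z, m (m x y) z = m x (m y z)) (f g h : A →ₗ[K] A) (z : (A ⊗[K] A) ⊗[K] A) :
    TensorProduct.lift m (TensorProduct.map (TensorProduct.lift m ∘ₗ TensorProduct.map f g) h z) =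
      TensorProduct.lift m (TensorProduct.map f (TensorProduct.lift m ∘ₗ TensorProduct.map g h)
        (TensorProduct.assoc K _ _ _ z)) := by
  induction z with
  | zero => simp only [map_zero]
  | add x y hx hy => simp only [map_add, hx, hy]
  | tmul x c =>
  induction x with
  | zero => simp only [map_zero, TensorProduct.zero_tmul]
  | add x y hx hy => simp only [map_add, hx, hy, TensorProduct.add_tmul]
  | tmul a b => simp [hm]

theorem conv_assoc (f g h : GroveAlgebra K →ₗ[K] GroveAlgebra K) :
    conv (conv f g) h = conv f (conv g h) := by
  refine LinearMap.ext fun x => ?_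
  have hco := LinearMap.congr_fun (comul_coassoc (K := K)) x
  have h₁ : TensorProduct.map (conv f g) h = TensorProduct.map
      (TensorProduct.lift (triData K).star ∘ₗ TensorProduct.map f g) h ∘ₗ (comul K).rTensor _ := by
    rw [LinearMap.map_comp_rTensor]
    rfl
  have h₂ : TensorProduct.map f (conv g h) = TensorProduct.map f
      (TensorProduct.lift (triData K).star ∘ₗ TensorProduct.map g h) ∘ₗ (comul K).lTensor _ := by
    rw [LinearMap.map_comp_lTensor]
    rfl
  rw [conv, h₁, conv, h₂]
  simp only [LinearMap.comp_apply, LinearEquiv.coe_coe] at hco ⊢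
  rw [← hco]
  exact lift_map_assoc star_assoc _ _ _ _

/-- The convolution powers of the projection onto the augmentation ideal. -/
noncomputable def convPow (K : Type*) [Field K] : ℕ → GroveAlgebra K →ₗ[K] GroveAlgebra K
  | 0 => unitAug K
  | n + 1 => conv (projAug K) (convPow K n)

/-- The powers are built by multiplying on the left; this right-hand version is needed for the left
inverse property of the antipode. -/
theorem conv_convPow_projAug (n : ℕ) : conv (convPow K n) (projAug K) = convPow K (n + 1) := by
  induction n with
  | zero => rw [convPow, convPow, convPow, conv_unitAug_left, conv_unitAug_right]
  | succ n ih => rw [convPow, conv_assoc, ih, ← convPow]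

theorem id_eq_unitAug_add : (LinearMap.id : GroveAlgebra K →ₗ[K] GroveAlgebra K) =
    unitAug K + projAug K := by
  rw [projAug]
  abel

/-- Local nilpotency: π kills the unit, so each convolution factor uses up at least one unit of
degree, and Δ creates none. -/
theorem convPow_X {n : ℕ} {t : PTree} (h : t.deg < n) : convPow K n (X K t) = 0 := by
  induction n generalizing t with
  | zero => omega
  | succ n ih =>
    have key {z : GroveAlgebra K ⊗[K] GroveAlgebra K} (hz : z ∈ tensorDegLE K n) :
        TensorProduct.map (projAug K) (convPow K n) z = 0 := by
      induction hz using Submodule.span_induction with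
      | mem x hx =>
        obtain ⟨t, z, h, rfl⟩ := hx
        rw [TensorProduct.map_tmul]
        cases t with
        | leaf => rw [projAug_X_leaf, TensorProduct.zero_tmul]
        | node l mid r =>
          rw [deg_node] at h
          rw [ih (by omega), TensorProduct.tmul_zero]
      | zero => rw [map_zero]
      | add x y _ _ hx hy => rw [map_add, hx, hy, add_zero]
      | smul c x _ hx => rw [map_smul, hx, smul_zero]
    have hmono : tensorDegLE K t.deg ≤ tensorDegLE K n :=
      Submodule.span_mono fun _ ⟨u, z, h', hx⟩ => ⟨u, z, h'.trans (Nat.lt_succ_iff.1 h), hx⟩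
    rw [convPow, conv, LinearMap.comp_apply, LinearMap.comp_apply, key (hmono (comul_X_mem t)),
      map_zero]

/-- The partial sums of the geometric series for the antipode. -/
noncomputable def antipodeSum (K : Type*) [Field K] : ℕ → GroveAlgebra K →ₗ[K] GroveAlgebra K
  | 0 => convPow K 0
  | n + 1 => antipodeSum K n + (-1 : K) ^ (n + 1) • convPow K (n + 1)

/-- Since `id` is the convolution unit plus π, the alternating geometric sum telescopes and leaves
only the last power. -/
theorem conv_antipodeSum_id (n : ℕ) : conv (antipodeSum K n) LinearMap.id =
    unitAug K + (-1 : K) ^ n • convPow K (n + 1) := by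
  have h (k : ℕ) : conv (convPow K k) LinearMap.id = convPow K k + convPow K (k + 1) := by
    rw [id_eq_unitAug_add, conv_add_right, conv_unitAug_right, conv_convPow_projAug]
  induction n with
  | zero => rw [antipodeSum, h, pow_zero, one_smul, convPow]
  | succ n ih =>
    rw [antipodeSum, conv_add_left, conv_smul_left, h, ih]
    module

theorem conv_id_antipodeSum (n : ℕ) : conv LinearMap.id (antipodeSum K n) =
    unitAug K + (-1 : K) ^ n • convPow K (n + 1) := by
  have h (k : ℕ) : conv LinearMap.id (convPow K k) = convPow K k + convPow K (k + 1) := by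
    rw [id_eq_unitAug_add, conv_add_left, conv_unitAug_left, ← convPow]
  induction n with
  | zero => rw [antipodeSum, h, pow_zero, one_smul, convPow]
  | succ n ih =>
    rw [antipodeSum, conv_add_right, conv_smul_right, h, ih]
    module

/-- The antipode of the grove algebra. -/
noncomputable def antipode (K : Type*) [Field K] : GroveAlgebra K →ₗ[K] GroveAlgebra K :=
  Finsupp.linearCombination K fun t => antipodeSum K t.deg (X K t)

theorem antipode_X {t : PTree} {n : ℕ} (h : t.deg ≤ n) :
    antipode K (X K t) = antipodeSum K n (X K t) := by
  induction n, h using Nat.le_induction with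
  | base => simp [antipode, X]
  | succ n hn ih =>
    rw [antipodeSum, LinearMap.add_apply, LinearMap.smul_apply,
      convPow_X (Nat.lt_succ_of_le hn), smul_zero, add_zero, ih]

/-- The partial sums are stationary on a tree from its degree on, so one partial sum serves all left
factors of a given coproduct. -/
theorem rTensor_antipode {n : ℕ} {z : GroveAlgebra K ⊗[K] GroveAlgebra K}
    (hz : z ∈ tensorDegLE K n) : (antipode K).rTensor _ z = (antipodeSum K n).rTensor _ z := by
  induction hz using Submodule.span_induction with
  | mem x hx =>
    obtain ⟨t, z, h, rfl⟩ := hx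
    rw [LinearMap.rTensor_tmul, LinearMap.rTensor_tmul, antipode_X ((Nat.le_add_right _ _).trans h)]
  | zero => rw [map_zero, map_zero]
  | add x y _ _ hx hy => rw [map_add, hx, hy, map_add]
  | smul c x _ hx => rw [map_smul, hx, map_smul]

theorem lTensor_antipode {n : ℕ} {z : GroveAlgebra K ⊗[K] GroveAlgebra K}
    (hz : z ∈ tensorDegLE K n) : (antipode K).lTensor _ z = (antipodeSum K n).lTensor _ z := by
  induction hz using Submodule.span_induction with
  | mem x hx =>
    obtain ⟨t, z, h, rfl⟩ := hx
    rw [LinearMap.lTensor_tmul, LinearMap.lTensor_tmul, antipode_X ((Nat.le_add_left _ _).trans h)]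
  | zero => rw [map_zero, map_zero]
  | add x y _ _ hx hy => rw [map_add, hx, hy, map_add]
  | smul c x _ hx => rw [map_smul, hx, map_smul]

theorem conv_antipode_id : TensorProduct.lift (triData K).star ∘ₗ (antipode K).rTensor _ ∘ₗ
    comul K = (triData K).aug.smulRight (triData K).one := by
  refine LinearMap.ext fun x => ?_
  induction x using induction_X with
  | hadd x y hx hy => rw [map_add, hx, hy, map_add]
  | hsmul c x hx => rw [map_smul, hx, map_smul]
  | hX t =>
    have h := LinearMap.congr_fun (conv_antipodeSum_id (K := K) t.deg) (X K t)
    rw [LinearMap.add_apply, LinearMap.smul_apply, convPow_X (Nat.lt_succ_self _), smul_zero,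
      add_zero] at h
    rw [LinearMap.comp_apply, LinearMap.comp_apply, rTensor_antipode (comul_X_mem t)]
    exact h

theorem conv_id_antipode : TensorProduct.lift (triData K).star ∘ₗ (antipode K).lTensor _ ∘ₗ
    comul K = (triData K).aug.smulRight (triData K).one := by
  refine LinearMap.ext fun x => ?_
  induction x using induction_X with
  | hadd x y hx hy => rw [map_add, hx, hy, map_add]
  | hsmul c x hx => rw [map_smul, hx, map_smul]
  | hX t =>
    have h := LinearMap.congr_fun (conv_id_antipodeSum (K := K) t.deg) (X K t)
    rw [LinearMap.add_apply, LinearMap.smul_apply, convPow_X (Nat.lt_succ_self _), smul_zero,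
      add_zero] at h
    rw [LinearMap.comp_apply, LinearMap.comp_apply, lTensor_antipode (comul_X_mem t)]
    exact h

theorem isConnectedPHopf : (triData K).IsConnectedPHopf (comul K) where
  isAugTrialgebra := unitLaws.isAugTrialgebra triAxioms
  tensor_isAugTrialgebra :=
    unitLaws.tensor.isAugTrialgebra (TriData.triAxioms_tensor unitLaws triAxioms)
  coassoc := comul_coassoc
  counit_left := LinearMap.ext rTensor_aug_comul
  counit_right := LinearMap.ext lTensor_aug_comul
  map_one := comul_one
  map_prec x y _ _ := comul_prec x y
  map_succ x y _ _ := comul_succ x y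
  map_bullet x y _ _ := comul_bullet x y
  exists_antipode := ⟨antipode K, conv_antipode_id, conv_id_antipode⟩
  connected := comul_connected

end GroveAlgebra

/-! ### The involution -/

namespace PTree

theorem dagger_leaf : dagger leaf = leaf := by rw [dagger]

theorem dagger_node (l : PTree) (mid : List PTree) (r : PTree) :
    dagger (node l mid r) = node (dagger r) (mid.map dagger).reverse (dagger l) := by rw [dagger]

theorem dagger_dagger (t : PTree) : dagger (dagger t) = t := by
  induction t using PTree.induction_on with
  | leaf => rw [dagger_leaf, dagger_leaf]
  | node l mid r hl hmid hr =>
    rw [dagger_node, dagger_node, hl, hr, List.map_reverse, List.reverse_reverse, List.map_map]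
    congr 1
    exact (List.map_congr_left hmid).trans (List.map_id _)

end PTree

namespace TriData

variable {K A : Type*} [CommRing K] [AddCommGroup A] [Module K A] [StarRing K]
  {D : TriData K A} {inv : A →ₛₗ[starRingEnd K] A}

theorem IsInvolution.inv_star (h : D.IsInvolution inv) (x y : A) :
    inv (D.star x y) = D.star (inv y) (inv x) := by
  rw [star_apply, star_apply, map_add, map_add, map_add, map_smulₛₗ, h.inv_prec, h.inv_succ,
    h.inv_bullet, h.inv_one, h.aug_inv, h.aug_inv, map_mul, mul_comm (starRingEnd K _)]
  abel

theorem IsInvolution.tensor (h : D.IsInvolution inv) :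
    D.tensor.IsInvolution (TensorProduct.map inv inv) where
  inv_inv x := by
    induction x with
    | zero => simp only [map_zero]
    | add x y hx hy => simp only [map_add, hx, hy]
    | tmul a b => simp only [TensorProduct.map_tmul, h.inv_inv]
  inv_one := by rw [tensor_one, TensorProduct.map_tmul, h.inv_one]
  aug_inv x := by
    induction x with
    | zero => simp only [map_zero]
    | add x y hx hy => simp only [map_add, hx, hy]
    | tmul a b => simp only [TensorProduct.map_tmul, tensor_aug_tmul, h.aug_inv, map_mul]
  inv_prec x y := by
    induction x with
    | zero => simp only [map_zero, LinearMap.zero_apply]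
    | add x y hx hy => simp only [map_add, LinearMap.add_apply, hx, hy]
    | tmul a b =>
    induction y with
    | zero => simp only [map_zero, LinearMap.zero_apply]
    | add x y hx hy => simp only [map_add, LinearMap.add_apply, hx, hy]
    | tmul a' b' =>
    simp only [tensor_prec, tensor_succ, tensorOp_tmul, map_add, TensorProduct.map_tmul,
      map_smulₛₗ, h.inv_star, h.inv_prec, h.inv_one, h.aug_inv]
    -- Reversing the arguments has exchanged the two augmentation scalars.
    rw [smul_comm]
  inv_succ x y := by
    induction x with
    | zero => simp only [map_zero, LinearMap.zero_apply]
    | add x y hx hy => simp only [map_add, LinearMap.add_apply, hx, hy]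
    | tmul a b =>
    induction y with
    | zero => simp only [map_zero, LinearMap.zero_apply]
    | add x y hx hy => simp only [map_add, LinearMap.add_apply, hx, hy]
    | tmul a' b' =>
    simp only [tensor_prec, tensor_succ, tensorOp_tmul, map_add, TensorProduct.map_tmul,
      map_smulₛₗ, h.inv_star, h.inv_succ, h.inv_one, h.aug_inv]
    rw [smul_comm]
  inv_bullet x y := by
    induction x with
    | zero => simp only [map_zero, LinearMap.zero_apply]
    | add x y hx hy => simp only [map_add, LinearMap.add_apply, hx, hy]
    | tmul a b =>
    induction y with
    | zero => simp only [map_zero, LinearMap.zero_apply]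
    | add x y hx hy => simp only [map_add, LinearMap.add_apply, hx, hy]
    | tmul a' b' =>
    simp only [tensor_bullet, tensorOp_tmul, map_add, TensorProduct.map_tmul,
      map_smulₛₗ, h.inv_star, h.inv_bullet, h.inv_one, h.aug_inv]
    rw [smul_comm]

end TriData

namespace GroveAlgebra

variable {K : Type*} [Field K]

open PTree

section Involution

variable [StarRing K]

theorem dagger_X (t : PTree) : dagger K (X K t) = X K t.dagger := by
  simp [dagger, X]

/-- The conjugate-linear involution of the algebra of words that reverses each word and applies
the involution of trees to its letters. -/
noncomputable def wordDagger (K : Type*) [Field K] [StarRing K] :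
    Words K →ₛₗ[starRingEnd K] Words K where
  toFun w := w.coeff.sum fun L c => starRingEnd K c • word K (L.toList.map PTree.dagger).reverse
  map_add' x y := by
    rw [MonoidAlgebra.coeff_add, Finsupp.sum_add_index'] <;> simp [add_smul]
  map_smul' c x := by
    rw [MonoidAlgebra.coeff_smul, Finsupp.sum_smul_index'] <;> simp [Finsupp.smul_sum, mul_smul]

theorem wordDagger_word (L : List PTree) :
    wordDagger K (word K L) = word K (L.map PTree.dagger).reverse := by
  simp [wordDagger, word]

theorem wordDagger_mul (w w' : Words K) :
    wordDagger K (w * w') = wordDagger K w' * wordDagger K w := by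
  induction w using induction_word with
  | hadd x y hx hy => simp only [add_mul, map_add, hx, hy, mul_add]
  | hsmul c x hx => simp only [smul_mul_assoc, map_smulₛₗ, hx, mul_smul_comm]
  | hw L =>
  induction w' using induction_word with
  | hadd x y hx hy => simp only [add_mul, map_add, hx, hy, mul_add]
  | hsmul c x hx => simp only [smul_mul_assoc, map_smulₛₗ, hx, mul_smul_comm]
  | hw L' =>
  rw [← word_append, wordDagger_word, wordDagger_word, wordDagger_word, List.map_append,
    List.reverse_append, word_append]

theorem wordDagger_letter (x : GroveAlgebra K) :
    wordDagger K (letter K x) = letter K (dagger K x) := by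
  induction x using induction_X with
  | hadd x y hx hy => simp only [map_add, hx, hy]
  | hsmul c x hx => simp only [map_smul, map_smulₛₗ, hx]
  | hX t => rw [letter_X, wordDagger_word, dagger_X, letter_X]; rfl

theorem dagger_graftList (L : List PTree) :
    dagger K (graftList K L) = graftList K (L.map PTree.dagger).reverse := by
  rcases L with _ | ⟨l, L⟩
  · simp [graftList]
  rcases List.eq_nil_or_concat L with rfl | ⟨mid, r, rfl⟩
  · simp [graftList]
  rw [List.concat_eq_append, graftList_cons_append, dagger_X, dagger_node,
    ← graftList_cons_append]
  simp

theorem dagger_graftWord (w : Words K) :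
    dagger K (graftWord K w) = graftWord K (wordDagger K w) := by
  induction w using induction_word with
  | hadd x y hx hy => simp only [map_add, hx, hy]
  | hsmul c x hx => simp only [map_smul, map_smulₛₗ, hx]
  | hw L => rw [graftWord_word, wordDagger_word, graftWord_word, dagger_graftList]

/-- Reversing a word exchanges its end letters, which is why `†` swaps `≺` and `≻`. -/
theorem dagger_nodeL (l : GroveAlgebra K) (w : Words K) (r : GroveAlgebra K) :
    dagger K (nodeL l w r) = nodeL (dagger K r) (wordDagger K w) (dagger K l) := by
  rw [nodeL, dagger_graftWord, wordDagger_mul, wordDagger_mul, wordDagger_letter,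
    wordDagger_letter, ← mul_assoc, nodeL]

theorem dagger_one : dagger K (triData K).one = (triData K).one := by
  rw [one_eq, dagger_X, dagger_leaf]

theorem aug_dagger (x : GroveAlgebra K) :
    (triData K).aug (dagger K x) = starRingEnd K ((triData K).aug x) := by
  induction x using induction_X with
  | hadd x y hx hy => simp only [map_add, hx, hy]
  | hsmul c x hx => simp only [map_smul, map_smulₛₗ, hx, smul_eq_mul, map_mul]
  | hX t =>
    rw [dagger_X]
    cases t with
    | leaf => rw [dagger_leaf, aug_X_leaf, map_one]
    | node l mid r => rw [dagger_node, aug_X_node, aug_X_node, map_zero]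

theorem dagger_prec_nodeL (l : GroveAlgebra K) (w : Words K) (r z : GroveAlgebra K)
    (h : dagger K (r * z) = dagger K z * dagger K r) :
    dagger K ((triData K).prec (nodeL l w r) z) =
      (triData K).succ (dagger K z) (dagger K (nodeL l w r)) := by
  rw [prec_nodeL, dagger_nodeL, dagger_nodeL, succ_nodeL, ← mul_def, ← mul_def, h]

theorem dagger_succ_nodeL (z l : GroveAlgebra K) (w : Words K) (r : GroveAlgebra K)
    (h : dagger K (z * l) = dagger K l * dagger K z) :
    dagger K ((triData K).succ z (nodeL l w r)) =
      (triData K).prec (dagger K (nodeL l w r)) (dagger K z) := by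
  rw [succ_nodeL, dagger_nodeL, dagger_nodeL, prec_nodeL, ← mul_def, ← mul_def, h]

theorem dagger_bullet_nodeL (l : GroveAlgebra K) (w : Words K) (r l' : GroveAlgebra K)
    (w' : Words K) (r' : GroveAlgebra K) (h : dagger K (r * l') = dagger K l' * dagger K r) :
    dagger K ((triData K).bullet (nodeL l w r) (nodeL l' w' r')) =
      (triData K).bullet (dagger K (nodeL l' w' r')) (dagger K (nodeL l w r)) := by
  rw [bullet_nodeL, dagger_nodeL, dagger_nodeL, dagger_nodeL, bullet_nodeL, ← mul_def, ← mul_def,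
    wordDagger_mul, wordDagger_mul, wordDagger_letter, h, mul_assoc]

/-- The same induction on total degree as for Δ: each operation needs the antimorphism property only
on a smaller pair of trees. -/
theorem dagger_X_mul_X (t z : PTree) :
    dagger K (X K t * X K z) = dagger K (X K z) * dagger K (X K t) := by
  induction hn : t.deg + z.deg using Nat.strong_induction_on generalizing t z with
  | _ n ih =>
  rcases t with _ | ⟨l, mid, r⟩
  · change dagger K (1 * _) = _ * dagger K 1
    rw [one_def, dagger_one, ← one_def, one_mul, mul_one]
  rcases z with _ | ⟨l', mid', r'⟩
  · change dagger K (_ * 1) = dagger K 1 * _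
    rw [one_def, dagger_one, ← one_def, one_mul, mul_one]
  simp only [deg_node] at hn
  have h₁ := ih _ (by simp only [deg_node]; omega) r (node l' mid' r') rfl
  have h₂ := ih _ (by simp only [deg_node]; omega) (node l mid r) l' rfl
  have h₃ := ih _ (by omega) r l' rfl
  rw [mul_def, mul_def, TriData.star_apply, TriData.star_apply, aug_dagger, aug_dagger]
  simp only [← nodeL_X l mid r, ← nodeL_X l' mid' r'] at h₁ h₂ ⊢
  rw [map_add, map_add, map_add, dagger_prec_nodeL _ _ _ _ h₁, dagger_succ_nodeL _ _ _ _ h₂,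
    dagger_bullet_nodeL _ _ _ _ _ _ h₃, aug_nodeL, aug_nodeL, map_zero, mul_zero, zero_smul,
    map_zero]
  abel

theorem dagger_mul (x y : GroveAlgebra K) :
    dagger K (x * y) = dagger K y * dagger K x := by
  induction x using induction_X with
  | hadd x y hx hy => rw [add_mul, map_add, hx, hy, map_add, mul_add]
  | hsmul c x hx => rw [smul_mul_assoc, map_smulₛₗ, hx, map_smulₛₗ, mul_smul_comm]
  | hX t =>
  induction y using induction_X with
  | hadd x y hx hy => rw [mul_add, map_add, hx, hy, map_add, add_mul]
  | hsmul c x hx => rw [mul_smul_comm, map_smulₛₗ, hx, map_smulₛₗ, smul_mul_assoc]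
  | hX z => exact dagger_X_mul_X t z

theorem dagger_isInvolution : (triData K).IsInvolution (dagger K) where
  inv_inv x := by
    induction x using induction_X with
    | hadd x y hx hy => rw [map_add, map_add, hx, hy]
    | hsmul c x hx => rw [map_smulₛₗ, map_smulₛₗ, hx, starRingEnd_self_apply]
    | hX t => rw [dagger_X, dagger_X, dagger_dagger]
  inv_one := dagger_one
  aug_inv := aug_dagger
  inv_prec x y := by
    induction x using induction_X with
    | hadd x y hx hy => simp only [map_add, LinearMap.add_apply, hx, hy]
    | hsmul c x hx => simp only [map_smul, map_smulₛₗ, LinearMap.smul_apply, hx]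
    | hX t =>
    cases t with
    | leaf =>
      rw [← one_eq, unitLaws.one_prec, dagger_one, unitLaws.succ_one, map_zero]
    | node l mid r => rw [← nodeL_X, dagger_prec_nodeL _ _ _ _ (dagger_mul _ _)]
  inv_succ x y := by
    induction y using induction_X with
    | hadd x y hx hy => simp only [map_add, LinearMap.add_apply, hx, hy]
    | hsmul c x hx => simp only [map_smul, map_smulₛₗ, LinearMap.smul_apply, hx]
    | hX t =>
    cases t with
    | leaf =>
      rw [← one_eq, unitLaws.succ_one, dagger_one, unitLaws.one_prec, map_zero]
    | node l mid r => rw [← nodeL_X, dagger_succ_nodeL _ _ _ _ (dagger_mul _ _)]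
  inv_bullet x y := by
    induction x using induction_X with
    | hadd x y hx hy => simp only [map_add, LinearMap.add_apply, hx, hy]
    | hsmul c x hx => simp only [map_smul, map_smulₛₗ, LinearMap.smul_apply, hx]
    | hX t =>
    induction y using induction_X with
    | hadd x y hx hy => simp only [map_add, LinearMap.add_apply, hx, hy]
    | hsmul c x hx => simp only [map_smul, map_smulₛₗ, LinearMap.smul_apply, hx]
    | hX z =>
    cases t with
    | leaf =>
      rw [← one_eq, unitLaws.one_bullet, dagger_one, unitLaws.bullet_one, map_zero]
    | node l mid r =>
    cases z with
    | leaf =>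
      rw [← one_eq, unitLaws.bullet_one, dagger_one, unitLaws.one_bullet, map_zero]
    | node l' mid' r' =>
      rw [← nodeL_X, ← nodeL_X, dagger_bullet_nodeL _ _ _ _ _ _ (dagger_mul _ _)]

/-! ### Compatibility of the involution with the coproduct -/

theorem map_dagger_mul (x y : GroveAlgebra K ⊗[K] Words K) :
    TensorProduct.map (dagger K) (wordDagger K) (x * y) =
      TensorProduct.map (dagger K) (wordDagger K) y *
        TensorProduct.map (dagger K) (wordDagger K) x := by
  induction x with
  | zero => rw [zero_mul, map_zero, mul_zero]
  | add x y hx hy => rw [add_mul, map_add, hx, hy, map_add, mul_add]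
  | tmul a w =>
  induction y with
  | zero => rw [mul_zero, map_zero, zero_mul]
  | add x y hx hy => rw [mul_add, map_add, hx, hy, map_add, add_mul]
  | tmul b w' =>
  rw [Algebra.TensorProduct.tmul_mul_tmul, TensorProduct.map_tmul, TensorProduct.map_tmul,
    TensorProduct.map_tmul, Algebra.TensorProduct.tmul_mul_tmul, dagger_mul, wordDagger_mul]

theorem map_dagger_letterT (x : GroveAlgebra K ⊗[K] GroveAlgebra K) :
    TensorProduct.map (dagger K) (wordDagger K) (letterT x) =
      letterT (TensorProduct.map (dagger K) (dagger K) x) := by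
  induction x with
  | zero => simp only [map_zero]
  | add x y hx hy => simp only [map_add, hx, hy]
  | tmul a b =>
    rw [letterT_tmul, TensorProduct.map_tmul, TensorProduct.map_tmul, letterT_tmul,
      wordDagger_letter]

theorem map_dagger_graftT (x : GroveAlgebra K ⊗[K] Words K) :
    TensorProduct.map (dagger K) (dagger K) (graftT x) =
      graftT (TensorProduct.map (dagger K) (wordDagger K) x) := by
  induction x with
  | zero => simp only [map_zero]
  | add x y hx hy => simp only [map_add, hx, hy]
  | tmul a w =>
    rw [graftT_tmul, TensorProduct.map_tmul, TensorProduct.map_tmul, graftT_tmul,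
      dagger_graftWord]

theorem map_dagger_nodeT (l : GroveAlgebra K ⊗[K] GroveAlgebra K)
    (w : GroveAlgebra K ⊗[K] Words K) (r : GroveAlgebra K ⊗[K] GroveAlgebra K) :
    TensorProduct.map (dagger K) (dagger K) (nodeT l w r) =
      nodeT (TensorProduct.map (dagger K) (dagger K) r)
        (TensorProduct.map (dagger K) (wordDagger K) w)
        (TensorProduct.map (dagger K) (dagger K) l) := by
  rw [nodeT, map_dagger_graftT, map_dagger_mul, map_dagger_mul, map_dagger_letterT,
    map_dagger_letterT, ← mul_assoc, nodeT]

/-- Since `†` reverses both the `⋆`-product of coefficients and the word of branches, it carries the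
recursion for Δ to itself with the branches in reverse order. -/
theorem comul_dagger_X (t : PTree) :
    comul K (dagger K (X K t)) = TensorProduct.map (dagger K) (dagger K) (comul K (X K t)) := by
  have hone : dagger K (1 : GroveAlgebra K) = 1 := dagger_one
  induction t using PTree.induction_on with
  | leaf =>
    change comul K (dagger K 1) = TensorProduct.map (dagger K) (dagger K) (comul K 1)
    rw [hone, comul_one, Algebra.TensorProduct.one_def, TensorProduct.map_tmul, hone]
  | node l mid r hl hmid hr =>
    have h : comulWords K (wordDagger K (word K mid)) =
        TensorProduct.map (dagger K) (wordDagger K) (comulWords K (word K mid)) := by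
      induction mid with
      | nil =>
        rw [wordDagger_word, List.map_nil, List.reverse_nil, word_nil, map_one,
          Algebra.TensorProduct.one_def, TensorProduct.map_tmul, hone, ← word_nil,
          wordDagger_word]
        rfl
      | cons s mid ih =>
        rw [word_cons, wordDagger_mul, map_mul, map_mul, map_dagger_mul,
          ih fun u hu => hmid u (List.mem_cons_of_mem _ hu), ← letter_X, wordDagger_letter,
          comulWords_letter, comulWords_letter, map_dagger_letterT, hmid s List.mem_cons_self]
    rw [← nodeL_X, dagger_nodeL, comul_nodeL, comul_nodeL, map_add, TensorProduct.map_tmul,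
      map_dagger_nodeT, dagger_nodeL, hl, hr, h, hone]

theorem comul_dagger (x : GroveAlgebra K) :
    comul K (dagger K x) = TensorProduct.map (dagger K) (dagger K) (comul K x) := by
  induction x using induction_X with
  | hadd x y hx hy => rw [map_add, map_add, hx, hy, map_add, map_add]
  | hsmul c x hx => rw [map_smulₛₗ, map_smul, hx, map_smul, map_smulₛₗ]
  | hX t => exact comul_dagger_X t

end Involution

/-! ### The Sweedler formula and primitive elements -/

theorem word_ofFn {n : ℕ} (v : Fin n → PTree) :
    (List.ofFn fun i => word K [v i]).prod = word K (List.ofFn v) := by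
  induction n with
  | zero => rw [List.ofFn_zero, List.ofFn_zero, List.prod_nil, word_nil]
  | succ n ih => rw [List.ofFn_succ, List.prod_cons, ih, List.ofFn_succ, ← word_cons]

theorem ofFn_eq_cons_append {α : Type*} {m : ℕ} (f : Fin (m + 2) → α) :
    List.ofFn f = f 0 :: ((List.ofFn fun i : Fin m => f i.castSucc.succ) ++
      [f (Fin.last (m + 1))]) := by
  rw [List.ofFn_succ, List.ofFn_succ_last]
  rfl

theorem graft_eq_graftWord {m : ℕ} (x : Fin (m + 2) → GroveAlgebra K) :
    graft K x = graftWord K (List.ofFn fun i => letter K (x i)).prod := by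
  -- Expanding each letter in the basis and using multilinearity of the product of words produces
  -- the sum over `Fintype.piFinset` that defines `graft`.
  have h : (fun i => letter K (x i)) = fun i => ∑ t ∈ (x i).support, x i t • word K [t] := rfl
  rw [← MultilinearMap.mkPiAlgebraFin_apply (R := K), h, MultilinearMap.map_sum_finset, map_sum]
  refine Finset.sum_congr rfl fun v _ => ?_
  rw [MultilinearMap.map_smul_univ, map_smul, MultilinearMap.mkPiAlgebraFin_apply, word_ofFn,
    graftWord_word, ofFn_eq_cons_append, graftList_cons_append]
  rfl

theorem prod_ofFn_tmul {A B : Type*} [Ring A] [Algebra K A] [Ring B] [Algebra K B] {n : ℕ}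
    (a : Fin n → A) (b : Fin n → B) :
    (List.ofFn fun i => a i ⊗ₜ[K] b i).prod = (List.ofFn a).prod ⊗ₜ (List.ofFn b).prod := by
  induction n with
  | zero => simp [Algebra.TensorProduct.one_def]
  | succ n ih => simp [List.ofFn_succ, ih]

/-- The left side depends only on the tensors and not on how they are written as sums, which
justifies the Sweedler notation. -/
theorem graftT_prod_sum {A : Type*} [Ring A] [Algebra K A] {m : ℕ} {N : Fin (m + 2) → ℕ}
    (a : (i : Fin (m + 2)) → Fin (N i) → A) (b : (i : Fin (m + 2)) → Fin (N i) → GroveAlgebra K) :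
    graftT (List.ofFn fun i => letterT (∑ j, a i j ⊗ₜ[K] b i j)).prod =
      ∑ j : (i : Fin (m + 2)) → Fin (N i),
        (List.ofFn fun i => a i (j i)).prod ⊗ₜ[K] graft K fun i => b i (j i) := by
  simp only [map_sum, letterT_tmul]
  rw [← MultilinearMap.mkPiAlgebraFin_apply (R := K), MultilinearMap.map_sum, map_sum]
  refine Finset.sum_congr rfl fun j _ => ?_
  rw [MultilinearMap.mkPiAlgebraFin_apply, prod_ofFn_tmul, graftT_tmul, graft_eq_graftWord]

theorem comul_X_graft {m : ℕ} (v : Fin (m + 2) → PTree) :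
    comul K (X K (PTree.graft v)) = X K (PTree.graft v) ⊗ₜ 1 +
      graftT (List.ofFn fun i => letterT (comul K (X K (v i)))).prod := by
  rw [PTree.graft, ← nodeL_X, comul_nodeL, comulWords_word, List.map_ofFn, nodeT,
    ofFn_eq_cons_append, List.prod_cons, List.prod_append, List.prod_singleton, mul_assoc]
  rfl

theorem sweedlerFormula : SweedlerFormula K (comul K) := by
  intro m v N a b h
  rw [comul_X_graft]
  simp only [h]
  rw [graftT_prod_sum]
  -- `starProd` unfolds to the product of a list in the ring with multiplication `⋆`.
  rfl

/-- In `Δx • Δy` the mixed terms vanish because `•` is zero as soon as one argument is the unit; for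
`≺` and `≻` a mixed term would survive. -/
theorem isPrimitive_bullet {x y : GroveAlgebra K} (hx : (triData K).IsPrimitive (comul K) x)
    (hy : (triData K).IsPrimitive (comul K) y) :
    (triData K).IsPrimitive (comul K) ((triData K).bullet x y) := by
  rw [TriData.IsPrimitive] at *
  rw [comul_bullet, hx, hy]
  simp [TriData.tensor_bullet, TriData.tensorOp_tmul, unitLaws.one_bullet, unitLaws.bullet_one,
    unitLaws.aug_one, unitLaws.one_star]

end GroveAlgebra

theorem mainTheorem9 (K : Type*) [Field K] [StarRing K] :
    ∃ Δ : GroveAlgebra K →ₗ[K] GroveAlgebra K ⊗[K] GroveAlgebra K,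
      (GroveAlgebra.triData K).IsInvolutiveConnectedPHopf (GroveAlgebra.dagger K) Δ ∧
      GroveAlgebra.SweedlerFormula K Δ ∧
      ∀ x y : GroveAlgebra K,
        (GroveAlgebra.triData K).IsPrimitive Δ x → (GroveAlgebra.triData K).IsPrimitive Δ y →
          (GroveAlgebra.triData K).IsPrimitive Δ ((GroveAlgebra.triData K).bullet x y) :=
  ⟨GroveAlgebra.comul K,
    { isConnectedPHopf := GroveAlgebra.isConnectedPHopf
      isInvolution := GroveAlgebra.dagger_isInvolution
      tensor_isInvolution := GroveAlgebra.dagger_isInvolution.tensor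
      map_inv := GroveAlgebra.comul_dagger },
    GroveAlgebra.sweedlerFormula, fun _ _ => GroveAlgebra.isPrimitive_bullet⟩
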